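/- Let $X$ and $Y$ be (real or complex) Hilbert spaces and let $T>0$. Let $A:D(A)\subset X\to X$ be the generator of a strongly continuous semigroup $e^{At}$ on $X$, and let $C:X\to Y$ be a bounded linear operator. Assume that $D(A)=D(A^*)$ and that $A+A^*=-Q$ on $D(A)$ for a bounded operator $Q\ge 0$. Assume that for some $\delta>0$ $$\int_0^T\|Ce^{At}x\|^2\,dt\ \ge\ \delta\|x\|^2\qquad\text{for all }x\in X,$$ and that $$e^{-\|Q/2\|T}\,\delta-3\|C\|^2\left(\frac{e^{\|Q/2\|T}-1}{\|Q/2\|}-T\right)>0,$$ where the expression in parentheses is read as its limit $0$ if $Q=0$. Let $\kappa_j>0$ $(j\ge 1)$ satisfy $\sum_{j=1}^\infty\kappa_j=\infty$ and $\sum_{j=1}^\infty\kappa_j^2<\infty$. Let $f\in L^1(0,T;X)$ and $y\in L^2(0,T;Y)$, and put $$J(x)=\frac12\int_0^T\|y(s)-Cz[x](s)\|^2\,ds,$$ where $z[x]$ is the mild solution of $\dot z=Az+f$, $z(0)=x$. Let $P(t)=e^{At}e^{A^*t}$. Then $J$ has a unique minimizer $x^o\in X$. Moreover, for every $x_0\in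 X$ the corrected back and forth nudging iteration on $[0,T]$, with $j=1,2,\dots$, $$\dot z_j^+(t)=Az_j^+(t)+f(t)+\kappa_jP(t)C^*\big(y(t)-Cz_j^+(t)\big),\qquad z_1^+(0)=x_0,\quad z_j^+(0)=z_{j-1}^-(T)\ \ (j\ge2),$$ $$\dot z_j^-(t)=-Az_j^-(t)-f(T-t)+\kappa_jP(T-t)C^*\big(y(T-t)-Cz_j^-(t)\big),\qquad z_j^-(0)=z_j^+(T),$$ has mild solutions $z_j^\pm\in C([0,T];X)$, and for all such solutions the initial state estimate $z_j^-(T)$ converges in the norm of $X$ to $x^o$ as $j\to\infty$. -/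

import Mathlib

open Set Filter Topology MeasureTheory

namespace BFN

section Semigroups

variable {𝕜 X : Type*} [RCLike 𝕜] [NormedAddCommGroup X] [InnerProductSpace 𝕜 X]
  [NormedSpace ℝ X]

/-- `S` is a strongly continuous semigroup of bounded operators on `X`. Only the times `t ≥ 0`
matter; the values of `S` at negative times are irrelevant. -/
structure IsC0Semigroup (S : ℝ → X →L[𝕜] X) : Prop where
  map_zero : S 0 = ContinuousLinearMap.id 𝕜 X
  map_add : ∀ s t : ℝ, 0 ≤ s → 0 ≤ t → S (s + t) = (S s).comp (S t)
  tendsto_zero : ∀ x : X, Tendsto (fun t : ℝ => S t x) (𝓝[>] 0) (𝓝 x)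

/-- `S` is a strongly continuous semigroup and the (in general unbounded) operator `A` is its
infinitesimal generator: `x ∈ D(A)` and `A x = v` if and only if `(S t x - x) / t → v` as
`t → 0+`. -/
def Generates (A : X →ₗ.[𝕜] X) (S : ℝ → X →L[𝕜] X) : Prop :=
  IsC0Semigroup S ∧
    ∀ x v : X, (x, v) ∈ A.graph ↔
      Tendsto (fun t : ℝ => t⁻¹ • (S t x - x)) (𝓝[>] 0) (𝓝 v)

/-- `A` is the generator of some strongly continuous semigroup. -/
def IsGenerator (A : X →ₗ.[𝕜] X) : Prop :=
  ∃ S : ℝ → X →L[𝕜] X, Generates A S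

open Classical in
/-- The operator `e^{At}` (for `t ≥ 0`), i.e. the semigroup generated by `A`, which at times
`t ≥ 0` is determined by `A`. It is set to `0` if `A` generates no semigroup. -/
noncomputable def expSemigroup (A : X →ₗ.[𝕜] X) (t : ℝ) : X →L[𝕜] X :=
  if h : IsGenerator A then h.choose t else 0

/-- `z` is a mild solution on `[0, T]` of `z'(t) = A z(t) + g(t, z(t))`, `z(0) = x₀`. -/
structure IsMildSolution (A : X →ₗ.[𝕜] X) (T : ℝ) (x₀ : X) (g : ℝ → X → X) (z : ℝ → X) :
    Prop where
  continuousOn : ContinuousOn z (Icc 0 T)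
  integrable : IntervalIntegrable (fun s => g s (z s)) volume 0 T
  eq : ∀ t ∈ Icc (0 : ℝ) T,
    z t = expSemigroup A t x₀ + ∫ s in (0 : ℝ)..t, expSemigroup A (t - s) (g s (z s))

/-- The (mild) solution `z[x]` of `z' = A z + f`, `z(0) = x`. -/
noncomputable def openLoop (A : X →ₗ.[𝕜] X) (f : ℝ → X) (x : X) (t : ℝ) : X :=
  expSemigroup A t x + ∫ s in (0 : ℝ)..t, expSemigroup A (t - s) (f s)

/-- The cost function `J(x) = 1/2 ∫₀ᵀ ‖y(s) - C z[x](s)‖² ds`. -/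
noncomputable def cost {Y : Type*} [NormedAddCommGroup Y] [InnerProductSpace 𝕜 Y]
    (A : X →ₗ.[𝕜] X) (C : X →L[𝕜] Y) (f : ℝ → X) (y : ℝ → Y) (T : ℝ) (x : X) : ℝ :=
  (1 / 2) * ∫ s in (0 : ℝ)..T, ‖y s - C (openLoop A f x s)‖ ^ 2

variable [CompleteSpace X]

/-- `A` is essentially skew-adjoint and dissipative: `D(A) = D(A*)` and `A + A* = -Q`, where `Q`
is a bounded operator with `Q ≥ 0`. -/
structure IsESAD (A : X →ₗ.[𝕜] X) (Q : X →L[𝕜] X) : Prop where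
  domain_eq : A.domain = A.adjoint.domain
  add_adjoint : ∀ (x : X) (hx : x ∈ A.domain) (hx' : x ∈ A.adjoint.domain),
    A ⟨x, hx⟩ + A.adjoint ⟨x, hx'⟩ = -(Q x)
  nonneg : Q.IsPositive

/-- The correction operator `P(t) = e^{At} e^{A*t}`. -/
noncomputable def correction (A : X →ₗ.[𝕜] X) (t : ℝ) : X →L[𝕜] X :=
  (expSemigroup A t).comp (expSemigroup A.adjoint t)

/-- `zp j` and `zm j`, `j = 0, 1, 2, …`, are the forward and the backward observers on `[0, T]`
of the back and forth nudging method with gains `κ j`, with feedback `κ j P(t) C*` in the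
forward observer and `κ j P(T - t) C*` in the backward observer, started from `x₀`.
The numbering of the iterations starts at `0`. -/
structure IsBFN {Y : Type*} [NormedAddCommGroup Y] [InnerProductSpace 𝕜 Y] [CompleteSpace Y]
    (A : X →ₗ.[𝕜] X) (C : X →L[𝕜] Y) (f : ℝ → X) (y : ℝ → Y) (T : ℝ) (κ : ℕ → ℝ) (x₀ : X)
    (zp zm : ℕ → ℝ → X) : Prop where
  forward : ∀ j : ℕ, IsMildSolution A T (if j = 0 then x₀ else zm (j - 1) T)
    (fun t z => f t + κ j • correction A t (ContinuousLinearMap.adjoint C (y t - C z))) (zp j)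
  backward : ∀ j : ℕ, IsMildSolution (-A) T (zp j T)
    (fun t z => -f (T - t) +
      κ j • correction A (T - t) (ContinuousLinearMap.adjoint C (y (T - t) - C z))) (zm j)

end Semigroups

/-- The quantity `(e^{qT} - 1) / q - T`, which is `0` (its limit) at `q = 0`. -/
noncomputable def expGap (q T : ℝ) : ℝ :=
  if q = 0 then 0 else (Real.exp (q * T) - 1) / q - T

end BFN

/-! Write `S t` for e^{At}. Since 2 Re⟨Ax, x⟩ = -⟨Qx, x⟩ lies between -‖Q‖‖x‖² and 0, and likewise
for A*, both `S t` and its adjoint are contractions bounded below by exp(-‖Q‖t/2). Hence `S t` is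
invertible, -A generates the inverses and A* the adjoints (`IsESAD.exists_inverse`).

Put W = C S, H = W*W, and r = W*(y - C z[xo]). Pull the error back to the initial time, e = S⁻¹(z -
z[xo]). As S⁻¹ P C* = S* C* = W*, the forward observer becomes e' = κ(r - H e), in which A no longer
appears; the backward observer gives the same equation with r and H reversed in time
(`forward_error`, `backward_error`). So each half-sweep is nearly a gradient step for the quadratic
functional J.

Observability makes the Gramian ∫H coercive. The normal equation ∫r = 0 is therefore solvable, and
its solution xo is the strict minimizer (`exists_leastSquares_minimizer`). Freezing e at its initial
value changes the result of a half-sweep only by O(κ²), so the error norm is at most (1 - δκ/2)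
times the old one plus cκ² (`exists_step_estimate`). With ∑κ = ∞ and ∑κ² < ∞ this forces convergence
to zero (`tendsto_zero_of_recursion`). -/

namespace BFN

/-! ### Strongly continuous operator families -/

section StronglyContinuous

variable {𝕜 E F G : Type*} [RCLike 𝕜] [NormedAddCommGroup E] [NormedSpace 𝕜 E]
  [NormedAddCommGroup F] [NormedSpace 𝕜 F] [NormedAddCommGroup G] [NormedSpace 𝕜 G]

/-- The operator family `U` is strongly continuous on `s`. -/
def StronglyContinuousOn (U : ℝ → E →L[𝕜] F) (s : Set ℝ) : Prop :=
  ∀ x : E, ContinuousOn (fun t => U t x) s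

/-- Split V_a' x' = V_a'(x' - x) + V_a' x: the uniform bound handles the first term, strong
continuity the second. -/
theorem continuous_uncurry_clm_of_bounded {α : Type*} [TopologicalSpace α] {V : α → E →L[𝕜] F}
    {M : ℝ} (hM : ∀ a, ‖V a‖ ≤ M) (hV : ∀ x, Continuous fun a => V a x) :
    Continuous fun p : α × E => V p.1 p.2 := by
  rw [continuous_iff_continuousAt]
  rintro ⟨a, x⟩
  have h1 : Tendsto (fun p : α × E => V p.1 (p.2 - x)) (𝓝 (a, x)) (𝓝 0) := by
    refine squeeze_zero_norm (a := fun p : α × E => M * ‖p.2 - x‖)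
      (fun p => (V p.1).le_of_opNorm_le (hM p.1) _) ?_
    have : Continuous fun p : α × E => M * ‖p.2 - x‖ := by fun_prop
    simpa using this.tendsto (a, x)
  have h2 : Tendsto (fun p : α × E => V p.1 x) (𝓝 (a, x)) (𝓝 (V a x)) :=
    ((hV x).comp continuous_fst).tendsto (a, x)
  have h := h1.add h2
  simp only [← map_add, sub_add_cancel, zero_add] at h
  exact h

namespace StronglyContinuousOn

variable {U : ℝ → E →L[𝕜] F} {V : ℝ → F →L[𝕜] G} {s : Set ℝ} {T : ℝ}

theorem exists_bound [CompleteSpace E] (hU : StronglyContinuousOn U s) (hs : IsCompact s) :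
    ∃ M, 0 ≤ M ∧ ∀ t ∈ s, ‖U t‖ ≤ M := by
  obtain ⟨C, hC⟩ := banach_steinhaus (g := fun t : s => U t) fun x => by
    obtain ⟨C, hC⟩ := hs.exists_bound_of_continuousOn (hU x)
    exact ⟨C, fun t => hC t t.2⟩
  exact ⟨max C 0, le_max_right _ _, fun t ht => (hC ⟨t, ht⟩).trans (le_max_left _ _)⟩

theorem continuousOn_apply [CompleteSpace E] (hU : StronglyContinuousOn U s) (hs : IsCompact s)
    {w : ℝ → E} (hw : ContinuousOn w s) : ContinuousOn (fun t => U t (w t)) s := by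
  obtain ⟨M, -, hM⟩ := hU.exists_bound hs
  rw [continuousOn_iff_continuous_domRestrict] at hw ⊢
  exact (continuous_uncurry_clm_of_bounded (V := fun t : s => U t) (fun t => hM t t.2)
    (fun x => (hU x).domRestrict)).comp (continuous_id.prodMk hw)

theorem comp [CompleteSpace F] (hV : StronglyContinuousOn V s) (hU : StronglyContinuousOn U s)
    (hs : IsCompact s) : StronglyContinuousOn (fun t => (V t).comp (U t)) s :=
  fun x => hV.continuousOn_apply hs (hU x)

theorem const_comp (B : F →L[𝕜] G) (hU : StronglyContinuousOn U s) :
    StronglyContinuousOn (fun t => B.comp (U t)) s :=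
  fun x => B.continuous.comp_continuousOn (hU x)

theorem comp_const (hV : StronglyContinuousOn V s) (B : E →L[𝕜] F) :
    StronglyContinuousOn (fun t => (V t).comp B) s :=
  fun x => hV (B x)

theorem comp_sub_left (hU : StronglyContinuousOn U (Icc 0 T)) :
    StronglyContinuousOn (fun t => U (T - t)) (Icc 0 T) := fun x =>
  (hU x).comp (by fun_prop) fun t ht => ⟨by linarith [ht.2], by linarith [ht.1]⟩

theorem intervalIntegrable_apply [CompleteSpace E] (hU : StronglyContinuousOn U (Icc 0 T))
    (hT : 0 ≤ T) {p : ℝ → E} (hp : IntervalIntegrable p volume 0 T) :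
    IntervalIntegrable (fun t => U t (p t)) volume 0 T := by
  obtain ⟨M, -, hM⟩ := hU.exists_bound isCompact_Icc
  rw [intervalIntegrable_iff_integrableOn_Ioc_of_le hT] at hp ⊢
  -- Freezing `U` outside [0, T] by projection gives a jointly continuous map, whence measurability
  -- for a merely measurable `p`.
  have hc : Continuous fun q : ℝ × E => U (projIcc 0 T hT q.1) q.2 :=
    continuous_uncurry_clm_of_bounded (V := fun t : ℝ => U (projIcc 0 T hT t))
      (fun t => hM _ (projIcc 0 T hT t).2)
      (fun x => (hU x).domRestrict.comp continuous_projIcc)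
  have hm : AEStronglyMeasurable (fun t => U (projIcc 0 T hT t) (p t))
      (volume.restrict (Ioc 0 T)) :=
    hc.comp_aestronglyMeasurable
      (aestronglyMeasurable_id.prodMk hp.aestronglyMeasurable)
  have hm' : AEStronglyMeasurable (fun t => U t (p t)) (volume.restrict (Ioc 0 T)) := by
    refine hm.congr ((ae_restrict_iff' measurableSet_Ioc).2 (Eventually.of_forall fun t ht => ?_))
    simp only [projIcc_of_mem hT ⟨ht.1.le, ht.2⟩]
  refine (hp.norm.const_mul M).mono' hm'
    ((ae_restrict_iff' measurableSet_Ioc).2 (Eventually.of_forall fun t ht => ?_))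
  exact (U t).le_of_opNorm_le (hM t ⟨ht.1.le, ht.2⟩) _

end StronglyContinuousOn

theorem intervalIntegrable_mono_right {p : ℝ → E} {t T : ℝ} (hp : IntervalIntegrable p volume 0 T)
    (ht : t ∈ Icc 0 T) : IntervalIntegrable p volume 0 t :=
  hp.mono_set (by rw [uIcc_of_le ht.1, uIcc_of_le (ht.1.trans ht.2)]; exact Icc_subset_Icc_right ht.2)

theorem intervalIntegrable_comp_sub_left {p : ℝ → E} {T : ℝ}
    (hp : IntervalIntegrable p volume 0 T) :
    IntervalIntegrable (fun t => p (T - t)) volume 0 T := by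
  simpa using (hp.comp_sub_left T).symm

/-- The real structure is a separate instance; it agrees with the one induced by 𝕜 because a
continuous real scalar action is determined by its rational scalars. -/
theorem coe_smul_eq_real_smul [NormedSpace ℝ E] (c : ℝ) (x : E) : (c : 𝕜) • x = c • x :=
  algebraMap_smul 𝕜 c x

theorem clm_map_real_smul [NormedSpace ℝ E] [NormedSpace ℝ F] (B : E →L[𝕜] F) (c : ℝ) (x : E) :
    B (c • x) = c • B x :=
  map_real_smul B B.continuous c x

/-- An operator that is bounded below and whose adjoint is injective is bijective. -/
theorem bijective_of_bound_below {H : Type*} [NormedAddCommGroup H] [InnerProductSpace 𝕜 H]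
    [CompleteSpace H] {B : H →L[𝕜] H} {c : ℝ} (hc : 0 < c) (h : ∀ x, c * ‖x‖ ≤ ‖B x‖)
    (h' : ∀ x, ContinuousLinearMap.adjoint B x = 0 → x = 0) : Function.Bijective B := by
  rw [ContinuousLinearMap.bijective_iff_dense_range_and_antilipschitz]
  constructor
  -- The orthogonal complement of the range is the kernel of the adjoint.
  · rw [Submodule.topologicalClosure_eq_top_iff, Submodule.eq_bot_iff]
    intro x hx
    apply h'
    rw [← inner_self_eq_zero (𝕜 := 𝕜), ContinuousLinearMap.adjoint_inner_left]
    rw [Submodule.mem_orthogonal'] at hx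
    exact hx _ ⟨_, rfl⟩
  · refine ⟨⟨c⁻¹, by positivity⟩, B.antilipschitz_of_bound fun x => ?_⟩
    have := h x
    change ‖x‖ ≤ c⁻¹ * ‖B x‖
    rwa [inv_mul_eq_div, le_div_iff₀' hc]

end StronglyContinuous
-- Strongly continuous semigroups and their generators
section C0Semigroup

variable {𝕜 X : Type*} [RCLike 𝕜] [NormedAddCommGroup X] [InnerProductSpace 𝕜 X]
  [NormedSpace ℝ X]

theorem generates_expSemigroup {A : X →ₗ.[𝕜] X} (hA : IsGenerator A) :
    Generates A (expSemigroup A) := by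
  have : expSemigroup A = hA.choose := by
    funext t
    simp [expSemigroup, hA]
  rw [this]
  exact hA.choose_spec

namespace IsC0Semigroup

variable [CompleteSpace X] {S : ℝ → X →L[𝕜] X}

omit [NormedSpace ℝ X] [CompleteSpace X] in
theorem tendsto_zero_right (hS : IsC0Semigroup S) (x : X) :
    Tendsto (fun s => S s x) (𝓝[≥] 0) (𝓝 x) := by
  rw [← Ioi_insert, nhdsWithin_insert, tendsto_sup]
  refine ⟨?_, hS.tendsto_zero x⟩
  rw [tendsto_pure_left]
  intro s hs
  simpa [hS.map_zero] using mem_of_mem_nhds hs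

omit [NormedSpace ℝ X] in
-- Otherwise some t_n → 0 has ‖S t_n‖ unbounded although every S t_n x converges, against
-- Banach–Steinhaus.
theorem exists_bound_near_zero (hS : IsC0Semigroup S) :
    ∃ ε > 0, ∃ M, 1 ≤ M ∧ ∀ t ∈ Icc 0 ε, ‖S t‖ ≤ M := by
  by_contra! hcon
  have hpos : ∀ n : ℕ, (0 : ℝ) < 1 / ((n : ℝ) + 1) := fun n => by positivity
  have hone : ∀ n : ℕ, (1 : ℝ) ≤ (n : ℝ) + 1 := fun n => by
    have : (0 : ℝ) ≤ n := n.cast_nonneg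
    linarith
  choose t ht hbig using fun n : ℕ => hcon _ (hpos n) _ (hone n)
  have ht0 : Tendsto t atTop (𝓝[≥] 0) := by
    refine tendsto_nhdsWithin_iff.2 ⟨?_, Eventually.of_forall fun n => (ht n).1⟩
    exact squeeze_zero (fun n => (ht n).1) (fun n => (ht n).2) tendsto_one_div_add_atTop_nhds_zero_nat
  obtain ⟨C, hC⟩ := banach_steinhaus (g := fun n => S (t n)) fun x => by
    obtain ⟨C, hC⟩ := ((hS.tendsto_zero_right x).comp ht0).norm.bddAbove_range
    exact ⟨C, fun n => hC ⟨n, rfl⟩⟩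
  obtain ⟨n, hn⟩ := exists_nat_gt C
  have h1 := hC n
  have h2 := hbig n
  linarith

omit [NormedSpace ℝ X] in
theorem exists_bound (hS : IsC0Semigroup S) (T : ℝ) :
    ∃ M, 0 ≤ M ∧ ∀ t ∈ Icc 0 T, ‖S t‖ ≤ M := by
  obtain ⟨ε, hε, M, hM, hb⟩ := hS.exists_bound_near_zero
  have key : ∀ n : ℕ, ∀ t ∈ Icc 0 (n * ε), ‖S t‖ ≤ M ^ (n + 1) := by
    intro n
    induction n with
    | zero =>
      intro t ht
      have : t = 0 := le_antisymm (by simpa using ht.2) ht.1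
      subst this
      simpa using hb 0 ⟨le_rfl, hε.le⟩
    | succ n ih =>
      intro t ht
      rcases le_total t ε with h | h
      · exact (hb t ⟨ht.1, h⟩).trans (le_self_pow₀ hM (by omega))
      · have h1 : S t = (S ε).comp (S (t - ε)) := by
          rw [← hS.map_add _ _ hε.le (by linarith)]
          congr 1; ring
        rw [h1, pow_succ']
        refine (ContinuousLinearMap.opNorm_comp_le _ _).trans ?_
        refine mul_le_mul (hb ε ⟨hε.le, le_rfl⟩) (ih _ ⟨by linarith, ?_⟩) (norm_nonneg _) (by linarith)
        have := ht.2
        push_cast at this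
        linarith
  obtain ⟨n, hn⟩ := exists_nat_gt (T / ε)
  refine ⟨M ^ (n + 1), by positivity, fun t ht => key n t ⟨ht.1, ht.2.trans ?_⟩⟩
  rw [div_lt_iff₀ hε] at hn
  exact hn.le

omit [NormedSpace ℝ X] in
-- S b - S a = S a (S (b - a) - 1) for a ≤ b, so the uniform bound reduces two-sided continuity to
-- continuity at 0.
theorem stronglyContinuousOn (hS : IsC0Semigroup S) (T : ℝ) :
    StronglyContinuousOn S (Icc 0 T) := by
  obtain ⟨M, hM0, hM⟩ := hS.exists_bound T
  intro x
  have key : ∀ a b, 0 ≤ a → a ≤ b → b ≤ T → ‖S b x - S a x‖ ≤ M * ‖S (b - a) x - x‖ := by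
    intro a b ha hab hb
    have : S b x = S a (S (b - a) x) := by
      rw [← ContinuousLinearMap.comp_apply, ← hS.map_add _ _ ha (by linarith)]
      congr 2; ring
    rw [this, ← map_sub]
    exact (S a).le_of_opNorm_le (hM a ⟨ha, by linarith⟩) _
  have key2 : ∀ a ∈ Icc 0 T, ∀ b ∈ Icc 0 T, ‖S b x - S a x‖ ≤ M * ‖S |b - a| x - x‖ := by
    intro a ha b hb
    rcases le_total a b with h | h
    · rw [abs_of_nonneg (by linarith)]
      exact key a b ha.1 h hb.2
    · rw [norm_sub_rev, abs_of_nonpos (by linarith), neg_sub]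
      exact key b a hb.1 h ha.2
  intro a ha
  rw [ContinuousWithinAt, tendsto_iff_norm_sub_tendsto_zero]
  have h1 : Tendsto (fun b : ℝ => |b - a|) (𝓝[Icc 0 T] a) (𝓝[≥] 0) := by
    refine tendsto_nhdsWithin_iff.2 ⟨?_, Eventually.of_forall fun b => mem_Ici.2 (abs_nonneg _)⟩
    have : Continuous fun b : ℝ => |b - a| := by fun_prop
    simpa using (this.tendsto a).mono_left nhdsWithin_le_nhds
  have h2 := ((hS.tendsto_zero_right x).comp h1).sub_const x |>.norm.const_mul M
  simp only [sub_self, norm_zero, mul_zero] at h2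
  exact squeeze_zero' (Eventually.of_forall fun b => norm_nonneg _)
    (eventually_nhdsWithin_of_forall fun b hb => key2 a ha b hb) h2

omit [NormedSpace ℝ X] in
theorem continuousOn_Ici (hS : IsC0Semigroup S) (x : X) :
    ContinuousOn (fun t => S t x) (Ici 0) := by
  intro a ha
  refine ((hS.stronglyContinuousOn (a + 1) x) a ⟨ha, by linarith⟩).mono_of_mem_nhdsWithin ?_
  rw [← Ici_inter_Iic]
  exact inter_mem self_mem_nhdsWithin (mem_nhdsWithin_of_mem_nhds (Iic_mem_nhds (by linarith)))

omit [NormedSpace ℝ X] in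
theorem intervalIntegrable (hS : IsC0Semigroup S) (x : X) {a b : ℝ} (ha : 0 ≤ a) (hb : 0 ≤ b) :
    IntervalIntegrable (fun t => S t x) volume a b :=
  ((hS.continuousOn_Ici x).mono fun t ht => by
    rcases le_total a b with h | h
    · rw [uIcc_of_le h] at ht; exact ha.trans ht.1
    · rw [uIcc_of_ge h] at ht; exact hb.trans ht.1).intervalIntegrable

theorem hasDerivWithinAt_integral (hS : IsC0Semigroup S) (x : X) {t : ℝ} (ht : 0 ≤ t) :
    HasDerivWithinAt (fun u => ∫ s in (0 : ℝ)..u, S s x) (S t x) (Ici 0) t := by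
  -- Values at negative times are arbitrary, so the orbit is extended by a constant before the
  -- fundamental theorem is applied.
  have hc : Continuous fun s : ℝ => S (max s 0) x :=
    (hS.continuousOn_Ici x).comp_continuous (by fun_prop) fun s => mem_Ici.2 (le_max_right _ _)
  have h := (hc.integral_hasStrictDerivAt 0 t).hasDerivAt.hasDerivWithinAt (s := Ici 0)
  simp only [max_eq_left ht] at h
  have heq : ∀ u ∈ Ici (0 : ℝ), ∫ s in (0 : ℝ)..u, S s x = ∫ s in (0 : ℝ)..u, S (max s 0) x := by
    intro u hu
    refine intervalIntegral.integral_congr fun s hs => ?_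
    rw [uIcc_of_le hu] at hs
    simp only [max_eq_left hs.1]
  exact h.congr heq (heq t ht)

end IsC0Semigroup

theorem _root_.HasDerivWithinAt.tendsto_slope_zero_Ici {E : Type*} [NormedAddCommGroup E]
    [NormedSpace ℝ E] {u : ℝ → E} {v : E} {t : ℝ} (h : HasDerivWithinAt u v (Ici t) t) :
    Tendsto (fun r : ℝ => r⁻¹ • (u (t + r) - u t)) (𝓝[>] 0) (𝓝 v) := by
  have h1 := (hasDerivWithinAt_iff_tendsto_slope' (self_notMem_Ioi)).1 (h.mono Ioi_subset_Ici_self)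
  have h2 : Tendsto (fun r : ℝ => t + r) (𝓝[>] 0) (𝓝[>] t) := by
    refine tendsto_nhdsWithin_iff.2 ⟨?_, eventually_nhdsWithin_of_forall fun r hr => ?_⟩
    · have : Continuous fun r : ℝ => t + r := by fun_prop
      simpa using (this.tendsto 0).mono_left nhdsWithin_le_nhds
    · simpa using hr
  simpa [Function.comp_def, slope] using h1.comp h2

theorem hasDerivWithinAt_Ici_of_tendsto_slope_zero {E : Type*} [NormedAddCommGroup E]
    [NormedSpace ℝ E] {u : ℝ → E} {v : E} {t : ℝ}
    (h : Tendsto (fun r : ℝ => r⁻¹ • (u (t + r) - u t)) (𝓝[>] 0) (𝓝 v)) :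
    HasDerivWithinAt u v (Ici t) t := by
  rw [← hasDerivWithinAt_Ioi_iff_Ici, hasDerivWithinAt_iff_tendsto_slope' self_notMem_Ioi]
  have h2 : Tendsto (fun r : ℝ => r - t) (𝓝[>] t) (𝓝[>] 0) := by
    refine tendsto_nhdsWithin_iff.2 ⟨?_, eventually_nhdsWithin_of_forall fun r hr => ?_⟩
    · have : Continuous fun r : ℝ => r - t := by fun_prop
      simpa using (this.tendsto t).mono_left nhdsWithin_le_nhds
    · simpa using hr
  refine (h.comp h2).congr fun r => ?_
  simp [slope_def_module]

namespace Generates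

variable [CompleteSpace X] {A : X →ₗ.[𝕜] X} {S : ℝ → X →L[𝕜] X}

/-- (S r - 1) ∫₀ᵗ S x equals ∫ over [t, t+r] minus ∫ over [0, r]; divide by r and let r → 0. -/
theorem integral_mem_graph (hA : Generates A S) (x : X) {t : ℝ} (ht : 0 ≤ t) :
    (∫ s in (0 : ℝ)..t, S s x, S t x - x) ∈ A.graph := by
  have hS := hA.1
  rw [hA.2]
  have h1 := ((hS.hasDerivWithinAt_integral x ht).mono (Ici_subset_Ici.2 ht)).tendsto_slope_zero_Ici
  have h2 := (hS.hasDerivWithinAt_integral x le_rfl).tendsto_slope_zero_Ici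
  have h := h1.sub h2
  simp only [hS.map_zero, ContinuousLinearMap.id_apply] at h
  refine h.congr' (eventually_nhdsWithin_of_forall fun r (hr : 0 < r) => ?_)
  dsimp only
  rw [← smul_sub, ← ContinuousLinearMap.intervalIntegral_comp_comm _
    (hS.intervalIntegrable x le_rfl ht)]
  congr 1
  have h3 : ∫ s in (0 : ℝ)..t, S r (S s x) = ∫ s in r..(t + r), S s x := by
    have := intervalIntegral.integral_comp_add_right (a := 0) (b := t) (fun s => S s x) r
    rw [zero_add] at this
    rw [← this]
    refine intervalIntegral.integral_congr fun s hs => ?_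
    rw [uIcc_of_le ht] at hs
    rw [add_comm s r, hS.map_add _ _ hr.le hs.1]
    rfl
  rw [h3, ← intervalIntegral.integral_interval_sub_left
    (hS.intervalIntegrable x le_rfl (by linarith)) (hS.intervalIntegrable x le_rfl hr.le)]
  simp only [zero_add, intervalIntegral.integral_same, sub_zero]
  abel

/-- The averages r⁻¹ ∫₀ʳ S x lie in the domain and tend to x. -/
theorem dense_domain (hA : Generates A S) : Dense (A.domain : Set X) := by
  intro x
  have h := (hA.1.hasDerivWithinAt_integral x le_rfl).tendsto_slope_zero_Ici
  simp only [hA.1.map_zero, ContinuousLinearMap.id_apply] at h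
  refine mem_closure_of_tendsto h (eventually_nhdsWithin_of_forall fun r (hr : 0 < r) => ?_)
  have h1 := LinearPMap.mem_domain_of_mem_graph (hA.integral_mem_graph x hr.le)
  rw [← coe_smul_eq_real_smul (𝕜 := 𝕜)]
  simpa using A.domain.smul_mem _ h1

omit [CompleteSpace X] in
theorem apply_mem_graph (hA : Generates A S) {x v : X} (hx : (x, v) ∈ A.graph) {t : ℝ}
    (ht : 0 ≤ t) : (S t x, S t v) ∈ A.graph := by
  have hS := hA.1
  rw [hA.2] at hx ⊢
  refine (((S t).continuous.tendsto v).comp hx).congr'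
    (eventually_nhdsWithin_of_forall fun r (hr : 0 < r) => ?_)
  simp only [Function.comp_apply, clm_map_real_smul, map_sub]
  rw [← ContinuousLinearMap.comp_apply, ← ContinuousLinearMap.comp_apply, ← hS.map_add _ _ ht hr.le,
    ← hS.map_add _ _ hr.le ht, add_comm]

/-- The generator only controls right derivatives, but a continuous function with vanishing right
derivative is constant. The integral formula then upgrades the derivative to a two-sided one. -/
theorem apply_eq_add_integral (hA : Generates A S) {x v : X} (hx : (x, v) ∈ A.graph) {t : ℝ}
    (ht : 0 ≤ t) : S t x = x + ∫ s in (0 : ℝ)..t, S s v := by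
  have hS := hA.1
  have hd : ∀ s ∈ Ico 0 t, HasDerivWithinAt (fun u => S u x - ∫ s in (0 : ℝ)..u, S s v)
      0 (Ici s) s := by
    intro s hs
    have h1 : HasDerivWithinAt (fun u => S u x) (S s v) (Ici s) s := by
      apply hasDerivWithinAt_Ici_of_tendsto_slope_zero
      have := (hA.2 _ _).1 (hA.apply_mem_graph hx hs.1)
      refine this.congr' (eventually_nhdsWithin_of_forall fun r (hr : 0 < r) => ?_)
      simp only
      rw [← ContinuousLinearMap.comp_apply, ← hS.map_add _ _ hr.le hs.1, add_comm]
    have h2 := (hS.hasDerivWithinAt_integral v hs.1).mono (Ici_subset_Ici.2 hs.1)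
    simpa [Pi.sub_def] using h1.sub h2
  have hc : ContinuousOn (fun u => S u x - ∫ s in (0 : ℝ)..u, S s v) (Icc 0 t) :=
    ((hS.continuousOn_Ici x).mono Icc_subset_Ici_self).sub fun s hs =>
      ((hS.hasDerivWithinAt_integral v hs.1).continuousWithinAt).mono Icc_subset_Ici_self
  have h := constant_of_has_deriv_right_zero hc hd t ⟨ht, le_rfl⟩
  simp only [hS.map_zero, intervalIntegral.integral_same, sub_zero,
    ContinuousLinearMap.id_apply] at h
  exact sub_eq_iff_eq_add.1 h

theorem hasDerivWithinAt (hA : Generates A S) {x v : X} (hx : (x, v) ∈ A.graph) {t : ℝ}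
    (ht : 0 ≤ t) : HasDerivWithinAt (fun u => S u x) (S t v) (Ici 0) t :=
  ((hA.1.hasDerivWithinAt_integral v ht).const_add x).congr
    (fun _ hu => hA.apply_eq_add_integral hx hu) (hA.apply_eq_add_integral hx ht)

end Generates
end C0Semigroup
-- Energy estimates; adjoint and inverse semigroups
section Energy

variable {𝕜 X : Type*} [RCLike 𝕜] [NormedAddCommGroup X] [InnerProductSpace 𝕜 X]
  [NormedSpace ℝ X]

/-- The integrating factor of Gronwall's inequality: the sign of this derivative gives both the
upper and the lower energy bound. -/
theorem hasDerivWithinAt_exp_mul_norm_sq {w : ℝ → X} {v : X} {t b : ℝ}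
    (hw : HasDerivWithinAt w v (Ici 0) t) (ht : 0 < t) :
    HasDerivAt (fun s => Real.exp (-(b * s)) * ‖w s‖ ^ 2)
      (Real.exp (-(b * t)) * (2 * RCLike.re (inner 𝕜 v (w t)) - b * ‖w t‖ ^ 2)) t := by
  have h1 := hw.hasDerivAt (Ici_mem_nhds ht)
  have h2 : HasDerivAt (fun s => ‖w s‖ ^ 2) (2 * RCLike.re (inner 𝕜 v (w t))) t := by
    have h3 := (RCLike.reCLM (K := 𝕜)).hasFDerivAt.comp_hasDerivAt t (h1.inner 𝕜 h1)
    simp only [Function.comp_def, RCLike.reCLM_apply, inner_self_eq_norm_sq, map_add] at h3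
    exact h3.congr_deriv (by rw [inner_re_symm (w t) v, two_mul])
  have h4 : HasDerivAt (fun s => Real.exp (-(b * s))) (Real.exp (-(b * t)) * (-b)) t := by
    have : HasDerivAt (fun s : ℝ => -(b * s)) (-b) t :=
      ((hasDerivAt_id t).const_mul b).neg.congr_deriv (by simp)
    exact this.exp
  exact (h4.mul h2).congr_deriv (by ring)

theorem continuousOn_exp_mul_norm_sq {w v : ℝ → X} (b : ℝ)
    (hw : ∀ t, 0 ≤ t → HasDerivWithinAt w (v t) (Ici 0) t) :
    ContinuousOn (fun s => Real.exp (-(b * s)) * ‖w s‖ ^ 2) (Ici 0) := by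
  have h : ContinuousOn w (Ici 0) := fun t ht => (hw t ht).continuousWithinAt
  fun_prop

theorem norm_sq_le_of_energy {w v : ℝ → X} {b : ℝ}
    (hw : ∀ t, 0 ≤ t → HasDerivWithinAt w (v t) (Ici 0) t)
    (hb : ∀ t, 0 ≤ t → 2 * RCLike.re (inner 𝕜 (v t) (w t)) ≤ b * ‖w t‖ ^ 2) {t : ℝ} (ht : 0 ≤ t) :
    ‖w t‖ ^ 2 ≤ Real.exp (b * t) * ‖w 0‖ ^ 2 := by
  have hd : ∀ s ∈ interior (Ici (0 : ℝ)), HasDerivAt (fun s => Real.exp (-(b * s)) * ‖w s‖ ^ 2)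
      (Real.exp (-(b * s)) * (2 * RCLike.re (inner 𝕜 (v s) (w s)) - b * ‖w s‖ ^ 2)) s := by
    intro s hs
    rw [interior_Ici] at hs
    exact hasDerivWithinAt_exp_mul_norm_sq (hw s (le_of_lt hs)) hs
  have hanti := antitoneOn_of_deriv_nonpos (convex_Ici 0) (continuousOn_exp_mul_norm_sq b hw)
    (fun s hs => (hd s hs).differentiableAt.differentiableWithinAt) fun s hs => by
      rw [(hd s hs).deriv]
      rw [interior_Ici] at hs
      exact mul_nonpos_of_nonneg_of_nonpos (Real.exp_pos _).le
        (sub_nonpos.2 (hb s (le_of_lt hs)))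
  have h := hanti (mem_Ici.2 le_rfl) (mem_Ici.2 ht) ht
  simp only [mul_zero, neg_zero, Real.exp_zero, one_mul, Real.exp_neg] at h
  rwa [inv_mul_le_iff₀ (Real.exp_pos _)] at h

theorem le_norm_sq_of_energy {w v : ℝ → X} {a : ℝ}
    (hw : ∀ t, 0 ≤ t → HasDerivWithinAt w (v t) (Ici 0) t)
    (ha : ∀ t, 0 ≤ t → a * ‖w t‖ ^ 2 ≤ 2 * RCLike.re (inner 𝕜 (v t) (w t))) {t : ℝ} (ht : 0 ≤ t) :
    Real.exp (a * t) * ‖w 0‖ ^ 2 ≤ ‖w t‖ ^ 2 := by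
  have hd : ∀ s ∈ interior (Ici (0 : ℝ)), HasDerivAt (fun s => Real.exp (-(a * s)) * ‖w s‖ ^ 2)
      (Real.exp (-(a * s)) * (2 * RCLike.re (inner 𝕜 (v s) (w s)) - a * ‖w s‖ ^ 2)) s := by
    intro s hs
    rw [interior_Ici] at hs
    exact hasDerivWithinAt_exp_mul_norm_sq (hw s (le_of_lt hs)) hs
  have hmono := monotoneOn_of_deriv_nonneg (convex_Ici 0) (continuousOn_exp_mul_norm_sq a hw)
    (fun s hs => (hd s hs).differentiableAt.differentiableWithinAt) fun s hs => by
      rw [(hd s hs).deriv]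
      rw [interior_Ici] at hs
      exact mul_nonneg (Real.exp_pos _).le (sub_nonneg.2 (ha s (le_of_lt hs)))
  have h := hmono (mem_Ici.2 le_rfl) (mem_Ici.2 ht) ht
  simp only [mul_zero, neg_zero, Real.exp_zero, one_mul, Real.exp_neg] at h
  rwa [le_inv_mul_iff₀ (Real.exp_pos _)] at h

namespace Generates

variable [CompleteSpace X] {A : X →ₗ.[𝕜] X} {S U : ℝ → X →L[𝕜] X} {a b : ℝ}

/-- Orbits starting in the domain are differentiable and obey the energy bound; density extends it
to all x. -/
theorem norm_sq_apply_le (hA : Generates A S)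
    (hb : ∀ x v, (x, v) ∈ A.graph → 2 * RCLike.re (inner 𝕜 v x) ≤ b * ‖x‖ ^ 2) {t : ℝ}
    (ht : 0 ≤ t) (x : X) : ‖S t x‖ ^ 2 ≤ Real.exp (b * t) * ‖x‖ ^ 2 := by
  refine hA.dense_domain.induction (P := fun x => ‖S t x‖ ^ 2 ≤ Real.exp (b * t) * ‖x‖ ^ 2)
    (fun x hx => ?_) (isClosed_le (by fun_prop) (by fun_prop)) x
  have hg := A.mem_graph ⟨x, hx⟩
  have h := norm_sq_le_of_energy (𝕜 := 𝕜) (fun s hs => hA.hasDerivWithinAt hg hs)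
    (fun s hs => hb _ _ (hA.apply_mem_graph hg hs)) ht
  simpa [hA.1.map_zero] using h

theorem le_norm_sq_apply (hA : Generates A S)
    (ha : ∀ x v, (x, v) ∈ A.graph → a * ‖x‖ ^ 2 ≤ 2 * RCLike.re (inner 𝕜 v x)) {t : ℝ}
    (ht : 0 ≤ t) (x : X) : Real.exp (a * t) * ‖x‖ ^ 2 ≤ ‖S t x‖ ^ 2 := by
  refine hA.dense_domain.induction (P := fun x => Real.exp (a * t) * ‖x‖ ^ 2 ≤ ‖S t x‖ ^ 2)
    (fun x hx => ?_) (isClosed_le (by fun_prop) (by fun_prop)) x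
  have hg := A.mem_graph ⟨x, hx⟩
  have h := le_norm_sq_of_energy (𝕜 := 𝕜) (fun s hs => hA.hasDerivWithinAt hg hs)
    (fun s hs => ha _ _ (hA.apply_mem_graph hg hs)) ht
  simpa [hA.1.map_zero] using h

/-- A quasi-dissipative operator generates at most one semigroup. -/
theorem unique (hS : Generates A S) (hU : Generates A U)
    (hb : ∀ x v, (x, v) ∈ A.graph → 2 * RCLike.re (inner 𝕜 v x) ≤ b * ‖x‖ ^ 2) {t : ℝ}
    (ht : 0 ≤ t) : S t = U t := by
  refine DFunLike.coe_injective ((S t).continuous.ext_on hS.dense_domain (U t).continuous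
    fun x hx => ?_)
  have hg := A.mem_graph ⟨x, hx⟩
  -- The difference of the two orbits of x solves the equation with zero initial energy.
  have h := norm_sq_le_of_energy (𝕜 := 𝕜)
    (fun s hs => (hS.hasDerivWithinAt hg hs).sub (hU.hasDerivWithinAt hg hs))
    (fun s hs => hb _ _ (A.graph.sub_mem (hS.apply_mem_graph hg hs) (hU.apply_mem_graph hg hs))) ht
  simp only [Pi.sub_apply, hS.1.map_zero, hU.1.map_zero, sub_self, norm_zero] at h
  rw [← sub_eq_zero, ← norm_eq_zero, ← sq_eq_zero_iff]
  exact le_antisymm (by simpa using h) (sq_nonneg _)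

/-- For a contraction, ‖S* x - x‖² ≤ 2‖x‖² - 2 Re⟨x, S x⟩, so strong continuity at 0 passes to the
adjoint. -/
theorem adjoint_isC0Semigroup (hA : Generates A S)
    (hb : ∀ x v, (x, v) ∈ A.graph → 2 * RCLike.re (inner 𝕜 v x) ≤ 0) :
    IsC0Semigroup fun t => ContinuousLinearMap.adjoint (S t) where
  map_zero := by
    rw [hA.1.map_zero, ← ContinuousLinearMap.one_def]
    exact ContinuousLinearMap.isSelfAdjoint_iff'.1 (IsSelfAdjoint.one _)
  map_add s t hs ht := by
    rw [add_comm, hA.1.map_add t s ht hs, ContinuousLinearMap.adjoint_comp]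
  tendsto_zero x := by
    have hn : ∀ t, 0 ≤ t → ‖S t‖ ≤ 1 := fun t ht =>
      ContinuousLinearMap.opNorm_le_bound _ zero_le_one fun y => by
        have := hA.norm_sq_apply_le (b := 0) (by simpa using hb) ht y
        rw [one_mul, ← sq_le_sq₀ (norm_nonneg _) (norm_nonneg _)]
        simpa using this
    have h1 : Tendsto (fun t => 2 * ‖x‖ ^ 2 - 2 * RCLike.re (inner 𝕜 x (S t x))) (𝓝[>] 0) (𝓝 0) := by
      have h := (hA.1.tendsto_zero x).inner (𝕜 := 𝕜) (tendsto_const_nhds (x := x))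
      have h2 := ((RCLike.continuous_re.tendsto _).comp h).const_mul 2 |>.const_sub (2 * ‖x‖ ^ 2)
      simp only [Function.comp_def, inner_self_eq_norm_sq, sub_self] at h2
      refine h2.congr fun t => ?_
      rw [inner_re_symm]
    rw [tendsto_iff_norm_sub_tendsto_zero]
    have h3 : Tendsto (fun t => ‖ContinuousLinearMap.adjoint (S t) x - x‖ ^ 2) (𝓝[>] 0) (𝓝 0) := by
      refine squeeze_zero' (Eventually.of_forall fun t => sq_nonneg _)
        (eventually_nhdsWithin_of_forall fun t (ht : 0 < t) => ?_) h1
      have h4 : ‖ContinuousLinearMap.adjoint (S t) x‖ ≤ ‖x‖ := by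
        refine (ContinuousLinearMap.le_of_opNorm_le _ (c := 1) ?_ x).trans (by simp)
        rw [LinearIsometryEquiv.norm_map]
        exact hn t ht.le
      rw [norm_sub_sq (𝕜 := 𝕜), ContinuousLinearMap.adjoint_inner_left]
      have := pow_le_pow_left₀ (norm_nonneg _) h4 2
      linarith
    have := h3.sqrt
    simpa [Real.sqrt_sq] using this

/-- The adjoint semigroup of a contraction semigroup is generated by the adjoint operator. -/
theorem adjoint (hA : Generates A S)
    (hb : ∀ x v, (x, v) ∈ A.graph → 2 * RCLike.re (inner 𝕜 v x) ≤ 0) :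
    Generates A.adjoint fun t => ContinuousLinearMap.adjoint (S t) := by
  have hS' := hA.adjoint_isC0Semigroup hb
  refine ⟨hS', fun x v => ⟨fun hx => ?_, fun h => ?_⟩⟩
  · have hform : ∀ y w, (y, w) ∈ A.graph → inner 𝕜 v y = inner 𝕜 x w := by
      intro y w hy
      obtain ⟨x', rfl, rfl⟩ := (LinearPMap.mem_graph_iff _).1 hx
      obtain ⟨y', rfl, rfl⟩ := (LinearPMap.mem_graph_iff _).1 hy
      exact LinearPMap.adjoint_isFormalAdjoint hA.dense_domain x' y'
    -- Test against u: ⟨S* x - x, u⟩ = ⟨x, S u - u⟩ = ⟨x, A ∫S u⟩ = ⟨v, ∫S u⟩.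
    have key : ∀ t, 0 ≤ t → ContinuousLinearMap.adjoint (S t) x - x =
        ∫ s in (0 : ℝ)..t, ContinuousLinearMap.adjoint (S s) v := by
      intro t ht
      refine ext_inner_right 𝕜 fun u => ?_
      rw [inner_sub_left, ContinuousLinearMap.adjoint_inner_left, ← inner_sub_right,
        ← hform _ _ (hA.integral_mem_graph u ht)]
      rw [← inner_conj_symm _ u, intervalIntegral.integral_of_le ht, intervalIntegral.integral_of_le ht,
        ← integral_inner (hA.1.intervalIntegrable u le_rfl ht).1,
        ← integral_inner (hS'.intervalIntegrable v le_rfl ht).1, ← integral_conj]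
      simp only [inner_conj_symm, ContinuousLinearMap.adjoint_inner_left]
    have h := (hS'.hasDerivWithinAt_integral v le_rfl).tendsto_slope_zero_Ici
    simp only [hS'.map_zero, ContinuousLinearMap.id_apply] at h
    refine h.congr' (eventually_nhdsWithin_of_forall fun r (hr : 0 < r) => ?_)
    simp only [key r hr.le, zero_add, intervalIntegral.integral_same, sub_zero]
  · have hform : ∀ y : A.domain, inner 𝕜 v (y : X) = inner 𝕜 x (A y) := by
      intro y
      have h1 := ((hA.2 _ _).1 (A.mem_graph y))
      have h2 := (tendsto_const_nhds (x := x)).inner (𝕜 := 𝕜) h1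
      have h3 := h.inner (𝕜 := 𝕜) (tendsto_const_nhds (x := (y : X)))
      refine tendsto_nhds_unique (h3.congr fun t => ?_) h2
      rw [← coe_smul_eq_real_smul (𝕜 := 𝕜), ← coe_smul_eq_real_smul (𝕜 := 𝕜), inner_smul_left,
        inner_smul_right, inner_sub_left, inner_sub_right, ContinuousLinearMap.adjoint_inner_left]
      simp
    have hx := LinearPMap.mem_adjoint_domain_of_exists x ⟨v, hform⟩
    rw [LinearPMap.mem_graph_iff]
    exact ⟨⟨x, hx⟩, rfl, LinearPMap.adjoint_apply_eq hA.dense_domain ⟨x, hx⟩ hform⟩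

/-- If the operators of a semigroup are invertible with locally bounded inverses, the inverses form
the semigroup generated by the negative of the generator. -/
theorem neg (hA : Generates A S) {R : ℝ → X →L[𝕜] X}
    (hSR : ∀ t, 0 ≤ t → (S t).comp (R t) = ContinuousLinearMap.id 𝕜 X)
    (hRS : ∀ t, 0 ≤ t → (R t).comp (S t) = ContinuousLinearMap.id 𝕜 X)
    {M : ℝ} (hM : ∀ t ∈ Icc (0 : ℝ) 1, ‖R t‖ ≤ M) : Generates (-A) R := by
  have hSR' : ∀ t, 0 ≤ t → ∀ x, S t (R t x) = x := fun t ht x => DFunLike.congr_fun (hSR t ht) x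
  have hRS' : ∀ t, 0 ≤ t → ∀ x, R t (S t x) = x := fun t ht x => DFunLike.congr_fun (hRS t ht) x
  have hev : ∀ᶠ t in 𝓝[>] (0 : ℝ), t ∈ Icc (0 : ℝ) 1 :=
    mem_of_superset (Ioc_mem_nhdsGT zero_lt_one) Ioc_subset_Icc_self
  -- R u = R (u - S v) + v, and R is bounded near 0.
  have hlim : ∀ {u : ℝ → X} {v : X}, Tendsto u (𝓝[>] 0) (𝓝 v) →
      Tendsto (fun t => R t (u t)) (𝓝[>] 0) (𝓝 v) := by
    intro u v hu
    have h1 : Tendsto (fun t => R t (u t - S t v)) (𝓝[>] 0) (𝓝 0) := by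
      have h2 := (hu.sub (hA.1.tendsto_zero v)).norm.const_mul M
      simp only [sub_self, norm_zero, mul_zero] at h2
      exact squeeze_zero_norm' (hev.mono fun t ht => (R t).le_of_opNorm_le (hM t ht) _) h2
    have h3 := h1.add_const v
    rw [zero_add] at h3
    refine h3.congr' (hev.mono fun t ht => ?_)
    simp only [map_sub, hRS' t ht.1, sub_add_cancel]
  have hlim' : ∀ {u : ℝ → X} {v : X}, Tendsto u (𝓝[>] 0) (𝓝 v) →
      Tendsto (fun t => S t (u t)) (𝓝[>] 0) (𝓝 v) := by
    intro u v hu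
    obtain ⟨M', -, hM'⟩ := hA.1.exists_bound 1
    have h1 : Tendsto (fun t => S t (u t - v)) (𝓝[>] 0) (𝓝 0) := by
      have h2 := (hu.sub_const v).norm.const_mul M'
      simp only [sub_self, norm_zero, mul_zero] at h2
      exact squeeze_zero_norm' (hev.mono fun t ht => (S t).le_of_opNorm_le (hM' t ht) _) h2
    have h3 := h1.add (hA.1.tendsto_zero v)
    rw [zero_add] at h3
    refine h3.congr fun t => ?_
    simp only [map_sub, sub_add_cancel]
  refine ⟨⟨?_, fun s t hs ht => ?_, fun x => hlim tendsto_const_nhds⟩, fun x v => ?_⟩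
  · have := hSR 0 le_rfl
    rwa [hA.1.map_zero, ContinuousLinearMap.id_comp] at this
  · ext x
    have h1 : S (s + t) (R s (R t x)) = x := by
      rw [add_comm, hA.1.map_add t s ht hs, ContinuousLinearMap.comp_apply, hSR' s hs, hSR' t ht]
    rw [← hRS' (s + t) (add_nonneg hs ht) (((R s).comp (R t)) x), ContinuousLinearMap.comp_apply, h1]
  · have hneg : (x, v) ∈ (-A).graph ↔ (x, -v) ∈ A.graph := by
      simp only [LinearPMap.mem_graph_iff]
      constructor
      · rintro ⟨y, hy, h⟩
        exact ⟨y, hy, by rw [← h, LinearPMap.neg_apply, neg_neg]⟩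
      · rintro ⟨y, hy, h⟩
        exact ⟨y, hy, by rw [LinearPMap.neg_apply, h, neg_neg]⟩
    rw [hneg, hA.2]
    -- Since R (S x - x) = -(R x - x), the maps -R and -S exchange the two difference quotients.
    constructor
    · intro h
      have h1 := (hlim h).neg
      rw [neg_neg] at h1
      refine h1.congr' (hev.mono fun t ht => ?_)
      simp only [clm_map_real_smul, map_sub, hRS' t ht.1, ← smul_neg, neg_sub]
    · intro h
      refine (hlim' h).neg.congr' (hev.mono fun t ht => ?_)
      simp only [clm_map_real_smul, map_sub, hSR' t ht.1, ← smul_neg, neg_sub]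

end Generates

namespace IsESAD

variable [CompleteSpace X] {A : X →ₗ.[𝕜] X} {Q : X →L[𝕜] X}

omit [NormedSpace ℝ X] in
-- Re⟨Ax, x⟩ = Re⟨A*x, x⟩, so twice either is -Re⟨Qx, x⟩. The upper bound yields contractivity, the
-- lower one invertibility, for A and A* alike.
theorem energy (hE : IsESAD A Q) (hd : Dense (A.domain : Set X)) {x : X} (hx : x ∈ A.domain)
    (hx' : x ∈ A.adjoint.domain) :
    RCLike.re (inner 𝕜 (A ⟨x, hx⟩) x) = RCLike.re (inner 𝕜 (A.adjoint ⟨x, hx'⟩) x) ∧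
    -‖Q‖ * ‖x‖ ^ 2 ≤ 2 * RCLike.re (inner 𝕜 (A ⟨x, hx⟩) x) ∧
    2 * RCLike.re (inner 𝕜 (A ⟨x, hx⟩) x) ≤ 0 := by
  have h1 : RCLike.re (inner 𝕜 (A ⟨x, hx⟩) x) = RCLike.re (inner 𝕜 (A.adjoint ⟨x, hx'⟩) x) := by
    have := LinearPMap.adjoint_isFormalAdjoint hd ⟨x, hx'⟩ ⟨x, hx⟩
    simp only at this
    rw [this, inner_re_symm]
  have h2 : 2 * RCLike.re (inner 𝕜 (A ⟨x, hx⟩) x) = -RCLike.re (inner 𝕜 (Q x) x) := by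
    have := congrArg (fun z => RCLike.re (inner 𝕜 z x)) (hE.add_adjoint x hx hx')
    simp only [inner_add_left, inner_neg_left, map_add, map_neg] at this
    linarith
  refine ⟨h1, ?_, ?_⟩
  · rw [h2, neg_mul, neg_le_neg_iff]
    refine (RCLike.re_le_norm _).trans ((norm_inner_le_norm _ _).trans ?_)
    rw [sq, ← mul_assoc]
    exact mul_le_mul_of_nonneg_right (Q.le_opNorm x) (norm_nonneg x)
  · rw [h2, neg_nonpos]
    exact hE.nonneg.re_inner_nonneg_left x

omit [NormedSpace ℝ X] in
theorem graph_energy (hE : IsESAD A Q) (hd : Dense (A.domain : Set X)) {x v : X}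
    (hx : (x, v) ∈ A.graph) :
    -‖Q‖ * ‖x‖ ^ 2 ≤ 2 * RCLike.re (inner 𝕜 v x) ∧ 2 * RCLike.re (inner 𝕜 v x) ≤ 0 := by
  obtain ⟨y, rfl, rfl⟩ := (LinearPMap.mem_graph_iff _).1 hx
  exact (hE.energy hd y.2 (hE.domain_eq ▸ y.2)).2

omit [NormedSpace ℝ X] in
theorem adjoint_graph_energy (hE : IsESAD A Q) (hd : Dense (A.domain : Set X)) {x v : X}
    (hx : (x, v) ∈ A.adjoint.graph) :
    -‖Q‖ * ‖x‖ ^ 2 ≤ 2 * RCLike.re (inner 𝕜 v x) ∧ 2 * RCLike.re (inner 𝕜 v x) ≤ 0 := by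
  obtain ⟨y, rfl, rfl⟩ := (LinearPMap.mem_graph_iff _).1 hx
  have hy : (y : X) ∈ A.domain := by rw [hE.domain_eq]; exact y.2
  obtain ⟨h1, h2⟩ := hE.energy hd hy y.2
  rwa [h1] at h2

/-- The semigroup generated by an essentially skew-adjoint dissipative operator consists of
invertible operators, the inverses form the semigroup generated by `-A`, and the adjoints form the
one generated by the adjoint of `A`. -/
theorem exists_inverse (hE : IsESAD A Q) (hA : IsGenerator A) :
    IsC0Semigroup (expSemigroup A) ∧ IsC0Semigroup (expSemigroup (-A)) ∧
    IsC0Semigroup (expSemigroup A.adjoint) ∧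
    (∀ t, 0 ≤ t → expSemigroup A.adjoint t = ContinuousLinearMap.adjoint (expSemigroup A t)) ∧
    (∀ t, 0 ≤ t → ∀ x, expSemigroup A t (expSemigroup (-A) t x) = x) ∧
    (∀ t, 0 ≤ t → ∀ x, expSemigroup (-A) t (expSemigroup A t x) = x) := by
  set S := expSemigroup A with hSdef
  have hS : Generates A S := generates_expSemigroup hA
  have hd := hS.dense_domain
  have hS' := hS.adjoint fun x v h => (hE.graph_energy hd h).2
  -- `expSemigroup` is an arbitrary choice of semigroup; uniqueness identifies it with the adjoints.
  have hadj : ∀ t, 0 ≤ t → expSemigroup A.adjoint t = ContinuousLinearMap.adjoint (S t) :=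
    fun t ht => (generates_expSemigroup ⟨_, hS'⟩).unique hS' (b := 0)
      (fun x v h => by simpa using (hE.adjoint_graph_energy hd h).2) ht
  have hlow : ∀ {B : X →L[𝕜] X} {t : ℝ},
      (∀ x, Real.exp (-‖Q‖ * t) * ‖x‖ ^ 2 ≤ ‖B x‖ ^ 2) →
      ∀ x, Real.exp (-‖Q‖ * t / 2) * ‖x‖ ≤ ‖B x‖ := by
    intro B t h x
    rw [← sq_le_sq₀ (by positivity) (norm_nonneg _), mul_pow, ← Real.exp_nat_mul]
    have : ((2 : ℕ) : ℝ) * (-‖Q‖ * t / 2) = -‖Q‖ * t := by push_cast; ring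
    rw [this]
    exact h x
  have hlowS : ∀ t, 0 ≤ t → ∀ x, Real.exp (-‖Q‖ * t / 2) * ‖x‖ ≤ ‖S t x‖ := fun t ht =>
    hlow fun x => hS.le_norm_sq_apply (fun x v h => (hE.graph_energy hd h).1) ht x
  have hlowS' : ∀ t, 0 ≤ t → ∀ x, Real.exp (-‖Q‖ * t / 2) * ‖x‖ ≤
      ‖ContinuousLinearMap.adjoint (S t) x‖ := fun t ht =>
    hlow fun x => hS'.le_norm_sq_apply (fun x v h => (hE.adjoint_graph_energy hd h).1) ht x
  have hbij : ∀ t, 0 ≤ t → Function.Bijective (S t) := fun t ht =>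
    bijective_of_bound_below (Real.exp_pos _) (hlowS t ht) fun x hx => by
      have := hlowS' t ht x
      rw [hx, norm_zero] at this
      exact norm_le_zero_iff.1 (nonpos_of_mul_nonpos_right this (Real.exp_pos _))
  have hex : ∀ t, ∃ R : X →L[𝕜] X, 0 ≤ t → (∀ x, S t (R x) = x) ∧ ∀ x, R (S t x) = x := by
    intro t
    by_cases ht : 0 ≤ t
    · let e := ContinuousLinearEquiv.ofBijective (S t)
        (LinearMap.ker_eq_bot.2 (hbij t ht).1) (LinearMap.range_eq_top.2 (hbij t ht).2)
      exact ⟨e.symm, fun _ => ⟨e.apply_symm_apply, e.symm_apply_apply⟩⟩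
    · exact ⟨0, fun h => absurd h ht⟩
  choose R hR using hex
  have hRneg : Generates (-A) R := by
    refine hS.neg (M := Real.exp (‖Q‖ / 2)) (fun t ht => ContinuousLinearMap.ext (hR t ht).1)
      (fun t ht => ContinuousLinearMap.ext (hR t ht).2) fun t ht => ?_
    refine ContinuousLinearMap.opNorm_le_bound _ (Real.exp_pos _).le fun x => ?_
    have h := hlowS t ht.1 (R t x)
    rw [(hR t ht.1).1] at h
    have h2 : Real.exp (-(‖Q‖ / 2)) ≤ Real.exp (-‖Q‖ * t / 2) := by
      rw [Real.exp_le_exp]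
      nlinarith [norm_nonneg Q, ht.2]
    have h3 := (mul_le_mul_of_nonneg_right h2 (norm_nonneg (R t x))).trans h
    rwa [Real.exp_neg, inv_mul_le_iff₀ (Real.exp_pos _)] at h3
  -- -A is not dissipative, but its energy rate is at most ‖Q‖, which suffices for uniqueness.
  have hRR : ∀ t, 0 ≤ t → expSemigroup (-A) t = R t := fun t ht =>
    (generates_expSemigroup ⟨_, hRneg⟩).unique hRneg (b := ‖Q‖) (fun x v h => by
      obtain ⟨y, rfl, rfl⟩ := (LinearPMap.mem_graph_iff _).1 h
      have := (hE.graph_energy hd (A.mem_graph y)).1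
      rw [LinearPMap.neg_apply, inner_neg_left, map_neg]
      linarith) ht
  refine ⟨hS.1, (generates_expSemigroup ⟨_, hRneg⟩).1,
    (generates_expSemigroup ⟨_, hS'⟩).1, hadj, fun t ht => ?_, fun t ht => ?_⟩
  · rw [hRR t ht]; exact (hR t ht).1
  · rw [hRR t ht]; exact (hR t ht).2

end IsESAD
end Energy
-- Linear Volterra equations
section Volterra

variable {𝕜 X : Type*} [RCLike 𝕜] [NormedAddCommGroup X] [InnerProductSpace 𝕜 X]
  [NormedSpace ℝ X] [CompleteSpace X]

theorem integral_exp_mul_le {l t : ℝ} (hl : 0 < l) :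
    ∫ s in (0 : ℝ)..t, Real.exp (l * s) ≤ Real.exp (l * t) / l := by
  rw [intervalIntegral.integral_comp_mul_left _ hl.ne', integral_exp, mul_zero, Real.exp_zero,
    smul_eq_mul, inv_mul_eq_div]
  gcongr
  linarith

omit [CompleteSpace X] in
theorem continuousOn_primitive_Icc {p : ℝ → X} {T : ℝ} (hT : 0 ≤ T)
    (hp : IntervalIntegrable p volume 0 T) :
    ContinuousOn (fun t => ∫ s in (0 : ℝ)..t, p s) (Icc 0 T) := by
  have := intervalIntegral.continuousOn_primitive_interval
    ((intervalIntegrable_iff' (by simp)).1 hp)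
  rwa [uIcc_of_le hT] at this

/-- A linear Volterra equation with strongly continuous kernel has a solution. -/
theorem exists_volterra_solution {T : ℝ} (hT : 0 ≤ T) {L : ℝ → X →L[𝕜] X}
    (hL : StronglyContinuousOn L (Icc 0 T)) {p : ℝ → X} (hp : IntervalIntegrable p volume 0 T)
    (x₀ : X) : ∃ u : ℝ → X, ContinuousOn u (Icc 0 T) ∧
      ∀ t ∈ Icc 0 T, u t = x₀ + ∫ s in (0 : ℝ)..t, (p s - L s (u s)) := by
  obtain ⟨M, hM0, hM⟩ := hL.exists_bound isCompact_Icc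
  -- Rescaling the unknown to ζ = e^{-lt}u makes the Picard map Lipschitz with constant M/l ≤ 1/2 on
  -- all of [0, T], so no subdivision is needed.
  set l : ℝ := 2 * M + 1 with hl
  have hl0 : 0 < l := by positivity
  have hext : ∀ ζ : C(Icc 0 T, X), Continuous (IccExtend hT ζ) := fun ζ => ζ.continuous.Icc_extend'
  have hker : ∀ ζ : C(Icc 0 T, X),
      ContinuousOn (fun s => Real.exp (l * s) • L s (IccExtend hT ζ s)) (Icc 0 T) := fun ζ =>
    ContinuousOn.smul (by fun_prop) (hL.continuousOn_apply isCompact_Icc (hext ζ).continuousOn)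
  have hkint : ∀ ζ : C(Icc 0 T, X), ∀ t ∈ Icc 0 T, IntervalIntegrable
      (fun s => Real.exp (l * s) • L s (IccExtend hT ζ s)) volume 0 t := fun ζ t ht =>
    intervalIntegrable_mono_right ((hker ζ).intervalIntegrable_of_Icc hT) ht
  have hc : ∀ ζ : C(Icc 0 T, X), ContinuousOn (fun t => Real.exp (-(l * t)) •
      (x₀ + (∫ s in (0 : ℝ)..t, p s) - ∫ s in (0 : ℝ)..t, Real.exp (l * s) • L s (IccExtend hT ζ s)))
      (Icc 0 T) := fun ζ =>
    ContinuousOn.smul (by fun_prop) ((continuousOn_const.add (continuousOn_primitive_Icc hT hp)).sub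
      (continuousOn_primitive_Icc hT (hkint ζ T ⟨hT, le_rfl⟩)))
  let Φ : C(Icc 0 T, X) → C(Icc 0 T, X) := fun ζ => ⟨_, (hc ζ).domRestrict⟩
  have hΦapp : ∀ ζ t (ht : t ∈ Icc 0 T), Φ ζ ⟨t, ht⟩ = Real.exp (-(l * t)) •
      (x₀ + (∫ s in (0 : ℝ)..t, p s) -
        ∫ s in (0 : ℝ)..t, Real.exp (l * s) • L s (IccExtend hT ζ s)) := fun _ _ _ => rfl
  have hΦ : ContractingWith (1 / 2) Φ := by
    refine ⟨by rw [← NNReal.coe_lt_coe]; norm_num, LipschitzWith.of_dist_le_mul fun ζ ξ => ?_⟩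
    rw [ContinuousMap.dist_le (by positivity)]
    rintro ⟨t, ht⟩
    rw [hΦapp, hΦapp, dist_eq_norm, ← smul_sub, sub_sub_sub_cancel_left,
      ← intervalIntegral.integral_sub (hkint ξ t ht) (hkint ζ t ht), norm_smul, Real.norm_eq_abs,
      Real.abs_exp]
    have hb : ‖∫ s in (0 : ℝ)..t, (Real.exp (l * s) • L s (IccExtend hT ξ s) -
        Real.exp (l * s) • L s (IccExtend hT ζ s))‖ ≤
        ∫ s in (0 : ℝ)..t, M * dist ζ ξ * Real.exp (l * s) := by
      refine intervalIntegral.norm_integral_le_of_norm_le ht.1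
        (Eventually.of_forall fun s hs => ?_)
        (Continuous.intervalIntegrable (by fun_prop) _ _)
      rw [← smul_sub, ← map_sub, norm_smul, Real.norm_eq_abs, Real.abs_exp, mul_comm]
      refine mul_le_mul_of_nonneg_right ?_ (Real.exp_pos _).le
      refine ((L s).le_of_opNorm_le (hM s ⟨hs.1.le, hs.2.trans ht.2⟩) _).trans ?_
      refine mul_le_mul_of_nonneg_left ?_ hM0
      rw [← dist_eq_norm, dist_comm]
      exact ContinuousMap.dist_apply_le_dist _
    rw [intervalIntegral.integral_const_mul] at hb
    have h1 := hb.trans (mul_le_mul_of_nonneg_left (integral_exp_mul_le hl0)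
      (mul_nonneg hM0 dist_nonneg))
    refine (mul_le_mul_of_nonneg_left h1 (Real.exp_pos _).le).trans ?_
    have h2 : Real.exp (-(l * t)) * (M * dist ζ ξ * (Real.exp (l * t) / l)) =
        M / l * dist ζ ξ := by
      rw [Real.exp_neg]
      field_simp
    rw [h2]
    refine mul_le_mul_of_nonneg_right ?_ dist_nonneg
    rw [div_le_iff₀ hl0]
    push_cast
    linarith
  have hfix := hΦ.fixedPoint_isFixedPt
  set ζ := ContractingWith.fixedPoint Φ hΦ
  refine ⟨fun t => Real.exp (l * t) • IccExtend hT ζ t,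
    (Continuous.smul (by fun_prop) (hext ζ)).continuousOn, fun t ht => ?_⟩
  have h1 := (DFunLike.congr_fun hfix.eq ⟨t, ht⟩).symm
  rw [hΦapp] at h1
  simp only [IccExtend_of_mem hT ζ ht, clm_map_real_smul]
  rw [h1, smul_smul, ← Real.exp_add, add_neg_cancel, Real.exp_zero, one_smul,
    intervalIntegral.integral_sub (intervalIntegrable_mono_right hp ht) (hkint ζ t ht)]
  abel

end Volterra

/-! ### Mild solutions when the semigroup is invertible -/

section Mild

variable {𝕜 X : Type*} [RCLike 𝕜] [NormedAddCommGroup X] [InnerProductSpace 𝕜 X]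
  [NormedSpace ℝ X] [CompleteSpace X] {U V : ℝ → X →L[𝕜] X} {T : ℝ}

omit [NormedSpace ℝ X] [CompleteSpace X] in
theorem IsC0Semigroup.apply_sub (hU : IsC0Semigroup U) (hUV : ∀ t, 0 ≤ t → ∀ x, U t (V t x) = x)
    {s t : ℝ} (hs : 0 ≤ s) (hst : s ≤ t) (x : X) : U (t - s) x = U t (V s x) := by
  have h : U t = (U (t - s)).comp (U s) := by
    rw [← hU.map_add _ _ (sub_nonneg.2 hst) hs, sub_add_cancel]
  rw [h, ContinuousLinearMap.comp_apply, hUV s hs]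

/-- U (t - s) = U t V s takes t out of the integrand, so the convolution in a mild solution becomes
a plain primitive. -/
theorem integral_convolution_eq (hU : IsC0Semigroup U) (hV : IsC0Semigroup V)
    (hUV : ∀ t, 0 ≤ t → ∀ x, U t (V t x) = x) {γ : ℝ → X} (hγ : IntervalIntegrable γ volume 0 T)
    {t : ℝ} (ht : t ∈ Icc 0 T) :
    ∫ s in (0 : ℝ)..t, U (t - s) (γ s) = U t (∫ s in (0 : ℝ)..t, V s (γ s)) := by
  rw [← ContinuousLinearMap.intervalIntegral_comp_comm _
    ((hV.stronglyContinuousOn t).intervalIntegrable_apply ht.1 (intervalIntegrable_mono_right hγ ht))]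
  refine intervalIntegral.integral_congr fun s hs => ?_
  rw [uIcc_of_le ht.1] at hs
  exact hU.apply_sub hUV hs.1 hs.2 _

theorem openLoop_eq {A : X →ₗ.[𝕜] X} (hU : IsC0Semigroup (expSemigroup A)) (hV : IsC0Semigroup V)
    (hUV : ∀ t, 0 ≤ t → ∀ x, expSemigroup A t (V t x) = x) {f : ℝ → X}
    (hf : IntervalIntegrable f volume 0 T) (x : X) {t : ℝ} (ht : t ∈ Icc 0 T) :
    openLoop A f x t = expSemigroup A t (x + ∫ s in (0 : ℝ)..t, V s (f s)) := by
  rw [openLoop, integral_convolution_eq hU hV hUV hf ht, map_add]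

theorem isMildSolution_iff {B : X →ₗ.[𝕜] X} (hU : IsC0Semigroup (expSemigroup B))
    (hV : IsC0Semigroup V) (hUV : ∀ t, 0 ≤ t → ∀ x, expSemigroup B t (V t x) = x) {x₀ : X}
    {g : ℝ → X → X} {z : ℝ → X} :
    IsMildSolution B T x₀ g z ↔ ContinuousOn z (Icc 0 T) ∧
      IntervalIntegrable (fun s => g s (z s)) volume 0 T ∧ ∀ t ∈ Icc (0 : ℝ) T,
        z t = expSemigroup B t (x₀ + ∫ s in (0 : ℝ)..t, V s (g s (z s))) := by
  constructor
  · rintro ⟨h1, h2, h3⟩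
    refine ⟨h1, h2, fun t ht => ?_⟩
    rw [h3 t ht, integral_convolution_eq hU hV hUV h2 ht, map_add]
  · rintro ⟨h1, h2, h3⟩
    refine ⟨h1, h2, fun t ht => ?_⟩
    rw [h3 t ht, integral_convolution_eq hU hV hUV h2 ht, map_add]

/-- Substituting z = U u leaves a Volterra equation for u with kernel V L U. -/
theorem exists_isMildSolution (hT : 0 ≤ T) {B : X →ₗ.[𝕜] X}
    (hU : IsC0Semigroup (expSemigroup B)) (hV : IsC0Semigroup V)
    (hUV : ∀ t, 0 ≤ t → ∀ x, expSemigroup B t (V t x) = x)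
    {L : ℝ → X →L[𝕜] X} (hL : StronglyContinuousOn L (Icc 0 T)) {p : ℝ → X}
    (hp : IntervalIntegrable p volume 0 T) (x₀ : X) :
    ∃ z, IsMildSolution B T x₀ (fun t x => p t - L t x) z := by
  have hUT := hU.stronglyContinuousOn T
  have hVT := hV.stronglyContinuousOn T
  obtain ⟨u, hu, hueq⟩ := exists_volterra_solution hT
    (hVT.comp (hL.comp hUT isCompact_Icc) isCompact_Icc) (hVT.intervalIntegrable_apply hT hp) x₀
  have hz := hUT.continuousOn_apply isCompact_Icc hu
  refine ⟨fun t => expSemigroup B t (u t), (isMildSolution_iff hU hV hUV).2 ⟨hz, ?_, ?_⟩⟩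
  · exact hp.sub ((hL.continuousOn_apply isCompact_Icc hz).intervalIntegrable_of_Icc hT)
  · intro t ht
    congr 1
    rw [hueq t ht]
    simp only [map_sub, ContinuousLinearMap.comp_apply]

end Mild
-- The scalar recursion
-- Subtracting the partial sums of cκ² leaves an eventually decreasing sequence bounded below, so
-- `a` converges. A limit ℓ > 0 would force a total decrease of at least δ(ℓ/2)∑κ = ∞.
theorem tendsto_zero_of_recursion {a κ : ℕ → ℝ} {δ c : ℝ} (hδ : 0 < δ) (ha : ∀ n, 0 ≤ a n)
    (hκ : ∀ n, 0 < κ n) (hsum : Tendsto (fun n => ∑ j ∈ Finset.range n, κ j) atTop atTop)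
    (hsq : Summable fun n => κ n ^ 2)
    (hrec : ∀ᶠ n in atTop, a (n + 1) ≤ (1 - δ * κ n) * a n + c * κ n ^ 2) :
    Tendsto a atTop (𝓝 0) := by
  set s : ℕ → ℝ := fun n => ∑ j ∈ Finset.range n, c * κ j ^ 2 with hs
  have hslim : Tendsto s atTop (𝓝 (∑' j, c * κ j ^ 2)) := (hsq.mul_left c).hasSum.tendsto_sum_nat
  set d : ℕ → ℝ := fun n => a n - s n with hd
  have hdrec : ∀ᶠ n in atTop, d (n + 1) ≤ d n - δ * κ n * a n := by
    filter_upwards [hrec] with n hn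
    simp only [hd, hs, Finset.sum_range_succ]
    linarith
  obtain ⟨b, hb⟩ := hslim.bddAbove_range
  have hdb : ∀ n, -b ≤ d n := fun n => by
    have h1 := hb ⟨n, rfl⟩
    have h2 := ha n
    simp only [hd]
    linarith
  obtain ⟨N, hN⟩ := eventually_atTop.1 hdrec
  have hanti : Antitone fun n => d (n + N) := antitone_nat_of_succ_le fun n => by
    have h1 := hN (n + N) (by omega)
    have h2 := mul_nonneg (mul_nonneg hδ.le (hκ (n + N)).le) (ha (n + N))
    rw [show n + 1 + N = n + N + 1 by ring]
    linarith
  have hdlim := tendsto_atTop_ciInf hanti ⟨-b, by rintro _ ⟨n, rfl⟩; exact hdb _⟩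
  rw [tendsto_add_atTop_iff_nat] at hdlim
  have halim := hdlim.add hslim
  simp only [hd, sub_add_cancel] at halim
  set ℓ := (⨅ n, (a (n + N) - s (n + N))) + ∑' j, c * κ j ^ 2
  have hℓ : 0 ≤ ℓ := ge_of_tendsto' halim ha
  rcases hℓ.eq_or_lt with h | h
  · rwa [← h] at halim
  exfalso
  have hev := hdrec.and (halim.eventually_const_le (half_lt_self h))
  obtain ⟨N', hN'⟩ := eventually_atTop.1 hev
  have hbd : ∀ n, d (n + N') + δ * (ℓ / 2) * ∑ j ∈ Finset.range (n + N'), κ j ≤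
      d N' + δ * (ℓ / 2) * ∑ j ∈ Finset.range N', κ j := by
    intro n
    induction n with
    | zero => simp
    | succ n ih =>
      obtain ⟨h1, h2⟩ := hN' (n + N') (by omega)
      rw [show n + 1 + N' = n + N' + 1 by ring, Finset.sum_range_succ]
      have h3 := mul_le_mul_of_nonneg_left h2 (mul_nonneg hδ.le (hκ (n + N')).le)
      linarith
  have htop : Tendsto (fun n => δ * (ℓ / 2) * ∑ j ∈ Finset.range (n + N'), κ j) atTop atTop :=
    ((tendsto_add_atTop_iff_nat N').2 hsum).const_mul_atTop (by positivity)
  obtain ⟨n, hn⟩ := (htop.eventually_gt_atTop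
    (d N' + δ * (ℓ / 2) * ∑ j ∈ Finset.range N', κ j + b)).exists
  have h1 := hbd n
  have h2 := hdb (n + N')
  linarith

/-! ### One half-sweep -/

section Step

variable {𝕜 X : Type*} [RCLike 𝕜] [NormedAddCommGroup X] [InnerProductSpace 𝕜 X]
  [NormedSpace ℝ X] [CompleteSpace X] {T : ℝ}

omit [CompleteSpace X] in
-- ‖x - κg‖² ≤ (1 - 2κδ + κ²K²)‖x‖², and 1 + 2a ≤ (1 + a)² with a = -κδ + κ²K²/2.
theorem norm_sub_smul_le {x g : X} {κ δ K : ℝ} (hκ : 0 ≤ κ) (hκδ : κ * δ ≤ 1)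
    (hg : δ * ‖x‖ ^ 2 ≤ RCLike.re (inner 𝕜 g x)) (hK : ‖g‖ ≤ K * ‖x‖) :
    ‖x - κ • g‖ ≤ (1 - κ * δ + κ ^ 2 * K ^ 2 / 2) * ‖x‖ := by
  have h0 : 0 ≤ 1 - κ * δ + κ ^ 2 * K ^ 2 / 2 := by
    have : 0 ≤ κ ^ 2 * K ^ 2 / 2 := by positivity
    linarith
  rw [← sq_le_sq₀ (norm_nonneg _) (by positivity), norm_sub_sq (𝕜 := 𝕜),
    ← coe_smul_eq_real_smul (𝕜 := 𝕜), inner_smul_real_right, norm_smul, RCLike.norm_ofReal,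
    RCLike.smul_re, inner_re_symm, abs_of_nonneg hκ]
  have h1 := mul_le_mul_of_nonneg_left hg hκ
  have h2 : (κ * ‖g‖) ^ 2 ≤ κ ^ 2 * K ^ 2 * ‖x‖ ^ 2 := by
    rw [mul_pow, mul_assoc, ← mul_pow K]
    gcongr
  have h3 : 0 ≤ (-(κ * δ) + κ ^ 2 * K ^ 2 / 2) ^ 2 * ‖x‖ ^ 2 := by positivity
  nlinarith

/-- One half-step of the nudging iteration contracts the error, up to second order in the gain. -/
theorem exists_step_estimate (hT : 0 ≤ T) {H : ℝ → X →L[𝕜] X}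
    (hH : StronglyContinuousOn H (Icc 0 T)) {r : ℝ → X} (hr : IntervalIntegrable r volume 0 T)
    (hr0 : ∫ s in (0 : ℝ)..T, r s = 0) {δ : ℝ} (hδ : 0 < δ)
    (hG : ∀ x, δ * ‖x‖ ^ 2 ≤ RCLike.re (inner 𝕜 (∫ s in (0 : ℝ)..T, H s x) x)) :
    ∃ c κ₀ : ℝ, 0 < κ₀ ∧ ∀ κ, 0 < κ → κ ≤ κ₀ → ∀ (e₀ : X) (e : ℝ → X),
      ContinuousOn e (Icc 0 T) →
      (∀ t ∈ Icc 0 T, e t = e₀ + ∫ s in (0 : ℝ)..t, κ • (r s - H s (e s))) →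
      κ * δ ≤ 1 ∧ ‖e T‖ ≤ (1 - δ / 2 * κ) * ‖e₀‖ + c * κ ^ 2 := by
  obtain ⟨M, hM0, hM⟩ := hH.exists_bound isCompact_Icc
  set R := ∫ s in (0 : ℝ)..T, ‖r s‖ with hR
  have hR0 : 0 ≤ R := intervalIntegral.integral_nonneg hT fun s _ => norm_nonneg _
  set K := M * T with hKdef
  have hK0 : 0 ≤ K := mul_nonneg hM0 hT
  set c := K * (R + 2 * K * (1 + R)) + K ^ 2 / 2 with hc
  have hc0 : 0 ≤ c := by positivity
  -- Ensures κ ≤ 1, κK ≤ 1/2, κδ ≤ 1 and κc ≤ δ/2, where `c` collects the second-order terms below.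
  set κ₀ := min (min 1 (1 / (2 * K + 1))) (min (1 / δ) (δ / (2 * c + 1))) with hκ₀
  refine ⟨c, κ₀, by positivity, fun κ hκ hκle e₀ e he heq => ?_⟩
  have hκ1 : κ ≤ 1 := hκle.trans ((min_le_left _ _).trans (min_le_left _ _))
  have hκK : κ * (2 * K + 1) ≤ 1 :=
    (le_div_iff₀ (by positivity)).1 (hκle.trans ((min_le_left _ _).trans (min_le_right _ _)))
  have hκδ : κ * δ ≤ 1 :=
    (le_div_iff₀ hδ).1 (hκle.trans ((min_le_right _ _).trans (min_le_left _ _)))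
  have hκc : κ * (2 * c + 1) ≤ δ :=
    (le_div_iff₀ (by positivity)).1 (hκle.trans ((min_le_right _ _).trans (min_le_right _ _)))
  refine ⟨hκδ, ?_⟩
  have hT' : T ∈ Icc 0 T := ⟨hT, le_rfl⟩
  have hHe : ∀ {w : ℝ → X}, ContinuousOn w (Icc 0 T) →
      IntervalIntegrable (fun s => H s (w s)) volume 0 T := fun hw =>
    (hH.continuousOn_apply isCompact_Icc hw).intervalIntegrable_of_Icc hT
  have hintle : ∀ {w : ℝ → X} {m : ℝ}, (∀ s ∈ Icc 0 T, ‖w s‖ ≤ m) → ∀ t ∈ Icc 0 T,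
      ‖∫ s in (0 : ℝ)..t, H s (w s)‖ ≤ K * m := by
    intro w m hw t ht
    have hm : 0 ≤ m := (norm_nonneg _).trans (hw T hT')
    have h1 : ‖∫ s in (0 : ℝ)..t, H s (w s)‖ ≤ M * m * |t - 0| := by
      refine intervalIntegral.norm_integral_le_of_norm_le_const fun s hs => ?_
      rw [uIoc_of_le ht.1] at hs
      have hs' : s ∈ Icc 0 T := ⟨hs.1.le, hs.2.trans ht.2⟩
      exact ((H s).le_of_opNorm_le (hM s hs') _).trans (mul_le_mul_of_nonneg_left (hw s hs') hM0)
    rw [sub_zero, abs_of_nonneg ht.1] at h1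
    refine h1.trans ?_
    rw [hKdef, mul_right_comm]
    exact mul_le_mul_of_nonneg_right (mul_le_mul_of_nonneg_left ht.2 hM0) hm
  have hrle : ∀ t ∈ Icc 0 T, ‖∫ s in (0 : ℝ)..t, r s‖ ≤ R := fun t ht =>
    (intervalIntegral.norm_integral_le_integral_norm ht.1).trans
      (intervalIntegral.integral_mono_interval le_rfl ht.1 ht.2
        (Eventually.of_forall fun s => norm_nonneg _) hr.norm)
  have hsplit : ∀ t ∈ Icc 0 T, e t - e₀ =
      κ • (∫ s in (0 : ℝ)..t, r s) - κ • ∫ s in (0 : ℝ)..t, H s (e s) := by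
    intro t ht
    rw [heq t ht, add_sub_cancel_left, intervalIntegral.integral_smul,
      intervalIntegral.integral_sub (intervalIntegrable_mono_right hr ht)
        (intervalIntegrable_mono_right (hHe he) ht), smul_sub]
  have hdiff : ∀ {m : ℝ}, (∀ s ∈ Icc 0 T, ‖e s‖ ≤ m) → ∀ t ∈ Icc 0 T,
      ‖e t - e₀‖ ≤ κ * (R + K * m) := by
    intro m hm t ht
    rw [hsplit t ht, ← smul_sub, norm_smul, Real.norm_eq_abs, abs_of_pos hκ]
    exact mul_le_mul_of_nonneg_left
      ((norm_sub_le _ _).trans (add_le_add (hrle t ht) (hintle hm t ht))) hκ.le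
  obtain ⟨t₀, ht₀, hmax⟩ := isCompact_Icc.exists_isMaxOn ⟨T, hT'⟩ he.norm
  have hm : ∀ s ∈ Icc 0 T, ‖e s‖ ≤ ‖e t₀‖ := fun s hs => hmax hs
  -- At the maximum m of ‖e‖, m ≤ ‖e₀‖ + κ(R + K m) ≤ ‖e₀‖ + R + m/2.
  have hm2 : ‖e t₀‖ ≤ 2 * (‖e₀‖ + R) := by
    have h1 := hdiff hm t₀ ht₀
    have h2 : ‖e t₀‖ ≤ ‖e₀‖ + ‖e t₀ - e₀‖ := by
      simpa using norm_add_le e₀ (e t₀ - e₀)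
    have h3 : κ * R ≤ 1 * R := mul_le_mul_of_nonneg_right hκ1 hR0
    have h4 : κ * K * ‖e t₀‖ ≤ 1 / 2 * ‖e t₀‖ := by
      refine mul_le_mul_of_nonneg_right ?_ (norm_nonneg _)
      linarith
    linarith
  have hd2 := hdiff fun s hs => (hm s hs).trans hm2
  -- Freeze e at `e₀`: `r` drops out by `hr0`, and the remainder is O(κ²) because e - e₀ is O(κ).
  have hfin : e T = (e₀ - κ • ∫ s in (0 : ℝ)..T, H s e₀) -
      κ • ∫ s in (0 : ℝ)..T, H s (e s - e₀) := by
    have h1 := hsplit T hT'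
    rw [hr0, smul_zero, zero_sub] at h1
    simp only [map_sub]
    rw [intervalIntegral.integral_sub (hHe he) (hHe continuousOn_const), smul_sub,
      eq_add_of_sub_eq h1]
    abel
  have hmain := norm_sub_smul_le (𝕜 := 𝕜) hκ.le hκδ (hG e₀)
    (hintle (w := fun _ => e₀) (fun _ _ => le_rfl) T hT')
  have hrem := hintle (w := fun s => e s - e₀) hd2 T hT'
  have h1 : ‖e T‖ ≤ (1 - κ * δ + κ ^ 2 * K ^ 2 / 2) * ‖e₀‖ +
      κ * (K * (κ * (R + K * (2 * (‖e₀‖ + R))))) := by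
    rw [hfin]
    refine (norm_sub_le _ _).trans (add_le_add hmain ?_)
    rw [norm_smul, Real.norm_eq_abs, abs_of_pos hκ]
    exact mul_le_mul_of_nonneg_left hrem hκ.le
  have h2 : (1 - κ * δ + κ ^ 2 * K ^ 2 / 2) * ‖e₀‖ +
      κ * (K * (κ * (R + K * (2 * (‖e₀‖ + R))))) ≤
      (1 - κ * δ) * ‖e₀‖ + κ ^ 2 * c * (1 + ‖e₀‖) := by
    have h3 : 0 ≤ κ ^ 2 * (K * (R + 2 * K * R) * ‖e₀‖ + 2 * K ^ 2 + K ^ 2 / 2) := by positivity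
    rw [hc]
    nlinarith
  -- Half of the contraction rate absorbs the second-order term proportional to ‖e₀‖.
  have h4 : κ ^ 2 * c * ‖e₀‖ ≤ κ * (δ / 2) * ‖e₀‖ := by
    refine mul_le_mul_of_nonneg_right ?_ (norm_nonneg _)
    rw [sq, mul_assoc]
    exact mul_le_mul_of_nonneg_left (by linarith) hκ.le
  nlinarith

end Step
-- The least-squares problem and its Gramian
section LeastSquares

variable {𝕜 X Y : Type*} [RCLike 𝕜] [NormedAddCommGroup X] [InnerProductSpace 𝕜 X]
  [NormedSpace ℝ X] [CompleteSpace X] [NormedAddCommGroup Y] [InnerProductSpace 𝕜 Y]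
  [CompleteSpace Y] {T : ℝ}

theorem re_inner_intervalIntegral {w : ℝ → X} (hw : IntervalIntegrable w volume 0 T) (x : X) :
    ∫ s in (0 : ℝ)..T, RCLike.re (inner 𝕜 x (w s)) =
      RCLike.re (inner 𝕜 x (∫ s in (0 : ℝ)..T, w s)) := by
  have h1 : IntervalIntegrable (fun s => innerSL 𝕜 x (w s)) volume 0 T :=
    ⟨(innerSL 𝕜 x).integrable_comp hw.1, (innerSL 𝕜 x).integrable_comp hw.2⟩
  have h2 := (innerSL 𝕜 x).intervalIntegral_comp_comm hw
  have h3 := (RCLike.reCLM (K := 𝕜)).intervalIntegral_comp_comm h1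
  rw [h2] at h3
  simpa using h3

omit [NormedSpace ℝ X] [CompleteSpace X] in
theorem intervalIntegrable_re_inner {w : ℝ → X} (hw : IntervalIntegrable w volume 0 T) (x : X) :
    IntervalIntegrable (fun s => RCLike.re (inner 𝕜 x (w s))) volume 0 T :=
  ⟨(RCLike.reCLM (K := 𝕜)).integrable_comp ((innerSL 𝕜 x).integrable_comp hw.1),
    (RCLike.reCLM (K := 𝕜)).integrable_comp ((innerSL 𝕜 x).integrable_comp hw.2)⟩

omit [CompleteSpace Y] in
theorem memLp_two_of_continuousOn {w : ℝ → Y} (hT : 0 ≤ T) (hw : ContinuousOn w (Icc 0 T)) :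
    MemLp w 2 (volume.restrict (Ioc 0 T)) := by
  obtain ⟨K, hK⟩ := isCompact_Icc.exists_bound_of_continuousOn hw
  exact MemLp.of_bound (hw.intervalIntegrable_of_Icc hT).1.aestronglyMeasurable K
    ((ae_restrict_iff' measurableSet_Ioc).2 (Eventually.of_forall fun t ht => hK t ⟨ht.1.le, ht.2⟩))

omit [CompleteSpace Y] in
theorem intervalIntegrable_of_memLp_two {w : ℝ → Y} (hT : 0 ≤ T)
    (hw : MemLp w 2 (volume.restrict (Ioc 0 T))) : IntervalIntegrable w volume 0 T := by
  rw [intervalIntegrable_iff_integrableOn_Ioc_of_le hT]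
  exact hw.integrable (by norm_num)

variable {W : ℝ → X →L[𝕜] Y}

theorem re_inner_integral_adjoint_comp_self
    (hH : StronglyContinuousOn (fun t => (ContinuousLinearMap.adjoint (W t)).comp (W t)) (Icc 0 T))
    (hT : 0 ≤ T) (x : X) :
    RCLike.re (inner 𝕜 (∫ s in (0 : ℝ)..T, ((ContinuousLinearMap.adjoint (W s)).comp (W s)) x) x) =
      ∫ s in (0 : ℝ)..T, ‖W s x‖ ^ 2 := by
  rw [inner_re_symm, ← re_inner_intervalIntegral ((hH x).intervalIntegrable_of_Icc hT)]
  simp only [ContinuousLinearMap.comp_apply, ContinuousLinearMap.adjoint_inner_right,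
    inner_self_eq_norm_sq]

/-- The observability Gramian of a strongly continuous observation is surjective. -/
theorem exists_gramian_eq (hT : 0 ≤ T) {δ : ℝ} (hδ : 0 < δ) {H : ℝ → X →L[𝕜] X}
    (hH : StronglyContinuousOn H (Icc 0 T))
    (hG : ∀ x, δ * ‖x‖ ^ 2 ≤ RCLike.re (inner 𝕜 (∫ s in (0 : ℝ)..T, H s x) x)) (x : X) :
    ∃ xo, ∫ s in (0 : ℝ)..T, H s xo = x := by
  obtain ⟨M, hM0, hM⟩ := hH.exists_bound isCompact_Icc
  have hint : ∀ x, IntervalIntegrable (fun s => H s x) volume 0 T := fun x =>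
    (hH x).intervalIntegrable_of_Icc hT
  let G₀ : X →ₗ[𝕜] X :=
    { toFun := fun x => ∫ s in (0 : ℝ)..T, H s x
      map_add' := fun x y => by
        simp only [map_add]
        exact intervalIntegral.integral_add (hint x) (hint y)
      map_smul' := fun c x => by
        simp only [map_smul]
        exact intervalIntegral.integral_smul c _ }
  let G : X →L[𝕜] X := G₀.mkContinuous (M * T) fun x => by
    have h1 : ‖∫ s in (0 : ℝ)..T, H s x‖ ≤ M * ‖x‖ * |T - 0| := by
      refine intervalIntegral.norm_integral_le_of_norm_le_const fun s hs => ?_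
      rw [uIoc_of_le hT] at hs
      exact (H s).le_of_opNorm_le (hM s ⟨hs.1.le, hs.2⟩) _
    rwa [sub_zero, abs_of_nonneg hT, mul_right_comm] at h1
  have hGx : ∀ x, δ * ‖x‖ ^ 2 ≤ RCLike.re (inner 𝕜 (G x) x) := hG
  -- As in Lax–Milgram, coercivity bounds G below and makes its adjoint injective.
  have hbij : Function.Bijective G := by
    refine bijective_of_bound_below hδ (fun x => ?_) fun x hx => ?_
    · have h1 := (hGx x).trans ((RCLike.re_le_norm _).trans (norm_inner_le_norm _ _))
      rcases (norm_nonneg x).eq_or_lt with h | h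
      · rw [← h, mul_zero]; exact norm_nonneg _
      · refine le_of_mul_le_mul_right ?_ h
        linarith
    · have h1 := hGx x
      rw [← ContinuousLinearMap.adjoint_inner_right, hx, inner_zero_right, map_zero] at h1
      have h2 : ‖x‖ ^ 2 ≤ 0 := nonpos_of_mul_nonpos_right h1 hδ
      simpa using le_antisymm h2 (sq_nonneg _)
  exact hbij.2 x

/-- The normal equation kills the cross term, so the cost at x exceeds that at xo by ∫‖W(x - xo)‖²,
which observability makes positive. -/
theorem exists_leastSquares_minimizer (hT : 0 ≤ T) {δ : ℝ} (hδ : 0 < δ)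
    (hW : StronglyContinuousOn W (Icc 0 T))
    (hW' : StronglyContinuousOn (fun t => ContinuousLinearMap.adjoint (W t)) (Icc 0 T))
    (hobs : ∀ x, δ * ‖x‖ ^ 2 ≤ ∫ s in (0 : ℝ)..T, ‖W s x‖ ^ 2) {b : ℝ → Y}
    (hb : MemLp b 2 (volume.restrict (Ioc 0 T))) :
    ∃ xo, ∫ s in (0 : ℝ)..T, ContinuousLinearMap.adjoint (W s) (b s - W s xo) = 0 ∧
      ∀ x, x ≠ xo → ∫ s in (0 : ℝ)..T, ‖b s - W s xo‖ ^ 2 < ∫ s in (0 : ℝ)..T, ‖b s - W s x‖ ^ 2 := by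
  have hH := hW'.comp hW isCompact_Icc
  have hbint := intervalIntegrable_of_memLp_two hT hb
  obtain ⟨xo, hxo⟩ := exists_gramian_eq hT hδ hH (fun x => by
    rw [re_inner_integral_adjoint_comp_self hH hT]; exact hobs x)
    (∫ s in (0 : ℝ)..T, ContinuousLinearMap.adjoint (W s) (b s))
  have hr : MemLp (fun s => b s - W s xo) 2 (volume.restrict (Ioc 0 T)) :=
    hb.sub (memLp_two_of_continuousOn hT (hW xo))
  have hr0 : ∫ s in (0 : ℝ)..T, ContinuousLinearMap.adjoint (W s) (b s - W s xo) = 0 := by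
    have hHxo : IntervalIntegrable (fun s => ContinuousLinearMap.adjoint (W s) (W s xo)) volume 0 T :=
      (hH xo).intervalIntegrable_of_Icc hT
    simp only [map_sub]
    rw [intervalIntegral.integral_sub (hW'.intervalIntegrable_apply hT hbint) hHxo, sub_eq_zero]
    exact hxo.symm
  refine ⟨xo, hr0, fun x hx => ?_⟩
  set h := x - xo with hh
  have hexp : ∀ s, ‖b s - W s x‖ ^ 2 = ‖b s - W s xo‖ ^ 2 -
      2 * RCLike.re (inner 𝕜 h (ContinuousLinearMap.adjoint (W s) (b s - W s xo))) +
      ‖W s h‖ ^ 2 := by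
    intro s
    have h1 : b s - W s x = (b s - W s xo) - W s h := by
      rw [hh, map_sub]; abel
    rw [h1, norm_sub_sq (𝕜 := 𝕜), ContinuousLinearMap.adjoint_inner_right,
      inner_re_symm (W s h)]
  have hri := hW'.intervalIntegrable_apply hT (intervalIntegrable_of_memLp_two hT hr)
  have hsq : IntervalIntegrable (fun s => ‖b s - W s xo‖ ^ 2) volume 0 T := by
    rw [intervalIntegrable_iff_integrableOn_Ioc_of_le hT]
    exact (memLp_two_iff_integrable_sq_norm hr.1).1 hr
  have hcr := (intervalIntegrable_re_inner (𝕜 := 𝕜) hri h).const_mul 2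
  have hWh : IntervalIntegrable (fun s => ‖W s h‖ ^ 2) volume 0 T :=
    ((hW h).norm.pow 2).intervalIntegrable_of_Icc hT
  simp only [hexp]
  rw [intervalIntegral.integral_add (hsq.sub hcr) hWh, intervalIntegral.integral_sub hsq hcr,
    intervalIntegral.integral_const_mul, re_inner_intervalIntegral hri, hr0]
  simp only [inner_zero_right, map_zero, mul_zero, sub_zero]
  have h2 : 0 < δ * ‖h‖ ^ 2 := by
    have : 0 < ‖h‖ := norm_pos_iff.2 (sub_ne_zero.2 hx)
    positivity
  linarith [hobs h]

end LeastSquares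

/-! ### The observers and their pulled-back errors -/

section Nudging

variable {𝕜 X Y : Type*} [RCLike 𝕜] [NormedAddCommGroup X] [InnerProductSpace 𝕜 X]
  [NormedSpace ℝ X] [CompleteSpace X] [NormedAddCommGroup Y] [InnerProductSpace 𝕜 Y]
  [CompleteSpace Y] {T : ℝ} {A : X →ₗ.[𝕜] X} {C : X →L[𝕜] Y} {f : ℝ → X} {y : ℝ → Y}

theorem exists_forward_observer (hT : 0 ≤ T) (hS : IsC0Semigroup (expSemigroup A))
    (hR : IsC0Semigroup (expSemigroup (-A))) (hS' : IsC0Semigroup (expSemigroup A.adjoint))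
    (hSR : ∀ t, 0 ≤ t → ∀ x, expSemigroup A t (expSemigroup (-A) t x) = x)
    (hf : IntervalIntegrable f volume 0 T) (hy : IntervalIntegrable y volume 0 T) (κ : ℝ) (x₀ : X) :
    ∃ z, IsMildSolution A T x₀
      (fun t z => f t + κ • correction A t (ContinuousLinearMap.adjoint C (y t - C z))) z := by
  have hP : StronglyContinuousOn (correction A) (Icc 0 T) :=
    (hS.stronglyContinuousOn T).comp (hS'.stronglyContinuousOn T) isCompact_Icc
  have hL : StronglyContinuousOn (fun t => (κ : 𝕜) • (correction A t).comp
      ((ContinuousLinearMap.adjoint C).comp C)) (Icc 0 T) := fun x =>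
    ((hP.comp_const ((ContinuousLinearMap.adjoint C).comp C)) x).const_smul (κ : 𝕜)
  have hp : IntervalIntegrable
      (fun t => f t + κ • correction A t (ContinuousLinearMap.adjoint C (y t))) volume 0 T :=
    hf.add (((hP.comp_const (ContinuousLinearMap.adjoint C)).intervalIntegrable_apply hT hy).smul κ)
  obtain ⟨z, hz⟩ := exists_isMildSolution hT hS hR hSR hL hp x₀
  refine ⟨z, ?_⟩
  convert hz using 3 with t x
  simp only [map_sub, smul_sub, smul_apply, ContinuousLinearMap.comp_apply,
    coe_smul_eq_real_smul, add_sub_assoc]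

theorem exists_backward_observer (hT : 0 ≤ T) (hS : IsC0Semigroup (expSemigroup A))
    (hR : IsC0Semigroup (expSemigroup (-A))) (hS' : IsC0Semigroup (expSemigroup A.adjoint))
    (hRS : ∀ t, 0 ≤ t → ∀ x, expSemigroup (-A) t (expSemigroup A t x) = x)
    (hf : IntervalIntegrable f volume 0 T) (hy : IntervalIntegrable y volume 0 T) (κ : ℝ) (x₀ : X) :
    ∃ z, IsMildSolution (-A) T x₀ (fun t z => -f (T - t) +
      κ • correction A (T - t) (ContinuousLinearMap.adjoint C (y (T - t) - C z))) z := by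
  have hP : StronglyContinuousOn (fun t => correction A (T - t)) (Icc 0 T) :=
    StronglyContinuousOn.comp_sub_left
      ((hS.stronglyContinuousOn T).comp (hS'.stronglyContinuousOn T) isCompact_Icc)
  have hL : StronglyContinuousOn (fun t => (κ : 𝕜) • (correction A (T - t)).comp
      ((ContinuousLinearMap.adjoint C).comp C)) (Icc 0 T) := fun x =>
    ((hP.comp_const ((ContinuousLinearMap.adjoint C).comp C)) x).const_smul (κ : 𝕜)
  have hp : IntervalIntegrable (fun t => -f (T - t) +
      κ • correction A (T - t) (ContinuousLinearMap.adjoint C (y (T - t)))) volume 0 T :=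
    (intervalIntegrable_comp_sub_left hf).neg.add
      (((hP.comp_const (ContinuousLinearMap.adjoint C)).intervalIntegrable_apply hT
        (intervalIntegrable_comp_sub_left hy)).smul κ)
  obtain ⟨z, hz⟩ := exists_isMildSolution hT hR hS hRS hL hp x₀
  refine ⟨z, ?_⟩
  convert hz using 3 with t x
  simp only [map_sub, smul_sub, smul_apply, ContinuousLinearMap.comp_apply,
    coe_smul_eq_real_smul, add_sub_assoc]

theorem exists_isBFN (κ : ℕ → ℝ) (x₀ : X)
    (hfwd : ∀ j x, ∃ z, IsMildSolution A T x
      (fun t z => f t + κ j • correction A t (ContinuousLinearMap.adjoint C (y t - C z))) z)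
    (hbwd : ∀ j x, ∃ z, IsMildSolution (-A) T x (fun t z => -f (T - t) +
      κ j • correction A (T - t) (ContinuousLinearMap.adjoint C (y (T - t) - C z))) z) :
    ∃ zp zm, IsBFN A C f y T κ x₀ zp zm := by
  choose F hF using hfwd
  choose B hB using hbwd
  -- The state from which sweep j starts, so `state (j + 1)` is the endpoint of backward sweep j.
  let state : ℕ → X := fun j => Nat.rec x₀ (fun j x => B j (F j x T) T) j
  refine ⟨fun j => F j (state j), fun j => B j (F j (state j) T), ⟨fun j => ?_, fun j => hB j _⟩⟩
  cases j with
  | zero => exact hF 0 x₀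
  | succ j => exact hF (j + 1) _

/-- The error of the forward observer, pulled back to the initial time, solves a Volterra
equation. -/
theorem forward_error (hT : 0 ≤ T) (hS : IsC0Semigroup (expSemigroup A))
    (hR : IsC0Semigroup (expSemigroup (-A)))
    (hadj : ∀ t, 0 ≤ t → expSemigroup A.adjoint t = ContinuousLinearMap.adjoint (expSemigroup A t))
    (hSR : ∀ t, 0 ≤ t → ∀ x, expSemigroup A t (expSemigroup (-A) t x) = x)
    (hRS : ∀ t, 0 ≤ t → ∀ x, expSemigroup (-A) t (expSemigroup A t x) = x)
    (hf : IntervalIntegrable f volume 0 T) {κ : ℝ} {x₀ : X} {z : ℝ → X}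
    (hz : IsMildSolution A T x₀
      (fun t z => f t + κ • correction A t (ContinuousLinearMap.adjoint C (y t - C z))) z)
    (xo : X) {e : ℝ → X}
    (he : ∀ t, e t = expSemigroup (-A) t (z t - openLoop A f xo t)) :
    ContinuousOn e (Icc 0 T) ∧ ∀ t ∈ Icc 0 T, e t = (x₀ - xo) + ∫ s in (0 : ℝ)..t,
      κ • (ContinuousLinearMap.adjoint (C.comp (expSemigroup A s)) (y s - C (openLoop A f xo s)) -
        ((ContinuousLinearMap.adjoint (C.comp (expSemigroup A s))).comp
          (C.comp (expSemigroup A s))) (e s)) := by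
  obtain ⟨hzc, hzi, hzeq⟩ := (isMildSolution_iff hS hR hSR).1 hz
  have hRT := hR.stronglyContinuousOn T
  have hRf := hRT.intervalIntegrable_apply hT hf
  have hRg := hRT.intervalIntegrable_apply hT hzi
  have hz0 : ∀ t ∈ Icc 0 T, expSemigroup (-A) t (openLoop A f xo t) =
      xo + ∫ s in (0 : ℝ)..t, expSemigroup (-A) s (f s) := fun t ht => by
    rw [openLoop_eq hS hR hSR hf xo ht, hRS t ht.1]
  constructor
  · have h1 : ContinuousOn (fun t => expSemigroup (-A) t (z t) -
        (xo + ∫ s in (0 : ℝ)..t, expSemigroup (-A) s (f s))) (Icc 0 T) :=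
      (hRT.continuousOn_apply isCompact_Icc hzc).sub
        (continuousOn_const.add (continuousOn_primitive_Icc hT hRf))
    refine h1.congr fun t ht => ?_
    rw [he, map_sub, hz0 t ht]
  · intro t ht
    rw [he, map_sub, hz0 t ht, hzeq t ht, hRS t ht.1, add_sub_add_comm,
      ← intervalIntegral.integral_sub (intervalIntegrable_mono_right hRg ht)
        (intervalIntegrable_mono_right hRf ht)]
    congr 1
    refine intervalIntegral.integral_congr fun s hs => ?_
    rw [uIcc_of_le ht.1] at hs
    -- Here the correction does its work: S⁻¹ P C* = S* C* = (C S)*, while C(z - z[xo]) = (C S) e.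
    simp only [he, correction, ContinuousLinearMap.comp_apply, ContinuousLinearMap.adjoint_comp,
      hSR s hs.1, hadj s hs.1, map_add, clm_map_real_smul, hRS s hs.1, add_sub_cancel_left]
    rw [← map_sub, ← map_sub, map_sub C, sub_sub_sub_cancel_right]

/-- The error of the backward observer, pulled back to the initial time, solves a Volterra
equation. -/
theorem backward_error (hT : 0 ≤ T) (hS : IsC0Semigroup (expSemigroup A))
    (hR : IsC0Semigroup (expSemigroup (-A)))
    (hadj : ∀ t, 0 ≤ t → expSemigroup A.adjoint t = ContinuousLinearMap.adjoint (expSemigroup A t))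
    (hSR : ∀ t, 0 ≤ t → ∀ x, expSemigroup A t (expSemigroup (-A) t x) = x)
    (hRS : ∀ t, 0 ≤ t → ∀ x, expSemigroup (-A) t (expSemigroup A t x) = x)
    (hf : IntervalIntegrable f volume 0 T) {κ : ℝ} {x₁ : X} {z : ℝ → X}
    (hz : IsMildSolution (-A) T x₁ (fun t z => -f (T - t) +
      κ • correction A (T - t) (ContinuousLinearMap.adjoint C (y (T - t) - C z))) z)
    (xo : X) {e : ℝ → X}
    (he : ∀ t, e t = expSemigroup (-A) (T - t) (z t - openLoop A f xo (T - t))) :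
    ContinuousOn e (Icc 0 T) ∧ ∀ t ∈ Icc 0 T,
      e t = expSemigroup (-A) T (x₁ - openLoop A f xo T) + ∫ s in (0 : ℝ)..t,
      κ • (ContinuousLinearMap.adjoint (C.comp (expSemigroup A (T - s)))
          (y (T - s) - C (openLoop A f xo (T - s))) -
        ((ContinuousLinearMap.adjoint (C.comp (expSemigroup A (T - s)))).comp
          (C.comp (expSemigroup A (T - s)))) (e s)) := by
  obtain ⟨hzc, hzi, hzeq⟩ := (isMildSolution_iff hR hS hRS).1 hz
  have hRT := hR.stronglyContinuousOn T
  have hRf := hRT.intervalIntegrable_apply hT hf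
  have hRf' := intervalIntegrable_comp_sub_left hRf
  have hSg := (hS.stronglyContinuousOn T).intervalIntegrable_apply hT hzi
  have hRg := hRT.comp_sub_left.intervalIntegrable_apply hT hzi
  have hsub : ∀ {t}, t ∈ Icc 0 T → T - t ∈ Icc 0 T := fun ht =>
    ⟨sub_nonneg.2 ht.2, by linarith [ht.1]⟩
  have hT' : T ∈ Icc 0 T := ⟨hT, le_rfl⟩
  have hz0 : ∀ t ∈ Icc 0 T, expSemigroup (-A) t (openLoop A f xo t) =
      xo + ∫ s in (0 : ℝ)..t, expSemigroup (-A) s (f s) := fun t ht => by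
    rw [openLoop_eq hS hR hSR hf xo ht, hRS t ht.1]
  -- The reference trajectory is rewritten from its value at T, the starting time of the backward
  -- sweep.
  have hz1 : ∀ t ∈ Icc 0 T, expSemigroup (-A) (T - t) (openLoop A f xo (T - t)) =
      expSemigroup (-A) T (openLoop A f xo T) -
        ∫ s in (0 : ℝ)..t, expSemigroup (-A) (T - s) (f (T - s)) := fun t ht => by
    rw [hz0 _ (hsub ht), hz0 T hT',
      intervalIntegral.integral_comp_sub_left (fun s => expSemigroup (-A) s (f s)) T, sub_zero,
      add_sub_assoc, ← intervalIntegral.integral_interval_sub_left hRf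
        (intervalIntegrable_mono_right hRf (hsub ht)), sub_sub_cancel]
  have hz2 : ∀ t ∈ Icc 0 T, expSemigroup (-A) (T - t) (z t) = expSemigroup (-A) T x₁ +
      ∫ s in (0 : ℝ)..t, expSemigroup (-A) (T - s) (-f (T - s) + κ • correction A (T - s)
        (ContinuousLinearMap.adjoint C (y (T - s) - C (z s)))) := fun t ht => by
    rw [hzeq t ht, hR.apply_sub hRS ht.1 ht.2, hSR t ht.1, map_add,
      ← ContinuousLinearMap.intervalIntegral_comp_comm _ (intervalIntegrable_mono_right hSg ht)]
    congr 1
    refine intervalIntegral.integral_congr fun s hs => ?_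
    rw [uIcc_of_le ht.1] at hs
    exact (hR.apply_sub hRS hs.1 (hs.2.trans ht.2) _).symm
  constructor
  · have h1 : ContinuousOn (fun t => expSemigroup (-A) (T - t) (z t) -
        (expSemigroup (-A) T (openLoop A f xo T) -
          ∫ s in (0 : ℝ)..t, expSemigroup (-A) (T - s) (f (T - s)))) (Icc 0 T) :=
      (hRT.comp_sub_left.continuousOn_apply isCompact_Icc hzc).sub
        (continuousOn_const.sub (continuousOn_primitive_Icc hT hRf'))
    refine h1.congr fun t ht => ?_
    rw [he, map_sub, hz1 t ht]
  · intro t ht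
    have hab : ∀ a b c d : X, a + b - (c - d) = (a - c) + (b + d) := fun a b c d => by abel
    rw [he, map_sub, hz1 t ht, hz2 t ht, hab, ← map_sub,
      ← intervalIntegral.integral_add (intervalIntegrable_mono_right hRg ht)
        (intervalIntegrable_mono_right hRf' ht)]
    congr 1
    refine intervalIntegral.integral_congr fun s hs => ?_
    rw [uIcc_of_le ht.1] at hs
    have hs' : 0 ≤ T - s := sub_nonneg.2 (hs.2.trans ht.2)
    -- The source terms ±f cancel, and the feedback keeps its sign, so the backward sweep also damps
    -- the error.
    simp only [he, correction, ContinuousLinearMap.comp_apply, ContinuousLinearMap.adjoint_comp,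
      hSR _ hs', hadj _ hs', map_add, map_neg, clm_map_real_smul, hRS _ hs', neg_add_cancel_comm]
    rw [← map_sub, ← map_sub, map_sub C, sub_sub_sub_cancel_right]

end Nudging
-- Convergence of the iteration
section Convergence

variable {𝕜 X Y : Type*} [RCLike 𝕜] [NormedAddCommGroup X] [InnerProductSpace 𝕜 X]
  [NormedSpace ℝ X] [CompleteSpace X] [NormedAddCommGroup Y] [InnerProductSpace 𝕜 Y]
  [CompleteSpace Y] {T : ℝ} {A : X →ₗ.[𝕜] X} {C : X →L[𝕜] Y} {f : ℝ → X} {y : ℝ → Y}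

omit [CompleteSpace X] in
theorem openLoop_eq_add (x : X) (t : ℝ) :
    openLoop A f x t = expSemigroup A t x + openLoop A f 0 t := by
  simp [openLoop]

theorem tendsto_of_isBFN (hT : 0 ≤ T) (hS : IsC0Semigroup (expSemigroup A))
    (hR : IsC0Semigroup (expSemigroup (-A)))
    (hadj : ∀ t, 0 ≤ t → expSemigroup A.adjoint t = ContinuousLinearMap.adjoint (expSemigroup A t))
    (hSR : ∀ t, 0 ≤ t → ∀ x, expSemigroup A t (expSemigroup (-A) t x) = x)
    (hRS : ∀ t, 0 ≤ t → ∀ x, expSemigroup (-A) t (expSemigroup A t x) = x)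
    (hf : IntervalIntegrable f volume 0 T) {xo : X} {r : ℝ → X} {H : ℝ → X →L[𝕜] X}
    (hrdef : ∀ s, r s =
      ContinuousLinearMap.adjoint (C.comp (expSemigroup A s)) (y s - C (openLoop A f xo s)))
    (hHdef : ∀ s, H s = (ContinuousLinearMap.adjoint (C.comp (expSemigroup A s))).comp
      (C.comp (expSemigroup A s)))
    (hH : StronglyContinuousOn H (Icc 0 T)) (hr : IntervalIntegrable r volume 0 T)
    (hr0 : ∫ s in (0 : ℝ)..T, r s = 0) {δ : ℝ} (hδ : 0 < δ)
    (hG : ∀ x, δ * ‖x‖ ^ 2 ≤ RCLike.re (inner 𝕜 (∫ s in (0 : ℝ)..T, H s x) x))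
    {κ : ℕ → ℝ} (hκ : ∀ j, 0 < κ j)
    (hκ_sum : Tendsto (fun n => ∑ j ∈ Finset.range n, κ j) atTop atTop)
    (hκ_sq : Summable fun j => κ j ^ 2) {x₀ : X} {zp zm : ℕ → ℝ → X}
    (hz : IsBFN A C f y T κ x₀ zp zm) : Tendsto (fun j => zm j T) atTop (𝓝 xo) := by
  obtain ⟨c₁, κ₁, hκ₁, h₁⟩ := exists_step_estimate hT hH hr hr0 hδ hG
  -- Time reversal preserves the integrals of `r` and `H`, so the same estimate covers the backward
  -- sweep.
  obtain ⟨c₂, κ₂, hκ₂, h₂⟩ := exists_step_estimate hT hH.comp_sub_left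
    (intervalIntegrable_comp_sub_left hr)
    (by rw [intervalIntegral.integral_comp_sub_left r T]; simpa using hr0) hδ
    (fun x => by
      rw [intervalIntegral.integral_comp_sub_left (fun s => H s x) T]; simpa using hG x)
  set a : ℕ → ℝ := fun j => ‖(if j = 0 then x₀ else zm (j - 1) T) - xo‖ with ha
  have hstep : ∀ j, κ j ≤ κ₁ → κ j ≤ κ₂ →
      a (j + 1) ≤ (1 - δ / 2 * κ j) * a j + (c₁ + c₂) * κ j ^ 2 := by
    intro j hj₁ hj₂
    obtain ⟨hc₁, he₁⟩ := forward_error hT hS hR hadj hSR hRS hf (hz.forward j) xo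
      (fun t => rfl)
    obtain ⟨hc₂, he₂⟩ := backward_error hT hS hR hadj hSR hRS hf (hz.backward j) xo
      (fun t => rfl)
    obtain ⟨hsmall, hfin₁⟩ := h₁ (κ j) (hκ j) hj₁ _ _ hc₁ fun t ht => by
      simpa only [hrdef, hHdef] using he₁ t ht
    obtain ⟨-, hfin₂⟩ := h₂ (κ j) (hκ j) hj₂ _ _ hc₂ fun t ht => by
      simpa only [hrdef, hHdef] using he₂ t ht
    -- At the end of the backward sweep the pull-back is the identity; at its start it equals the
    -- final pulled-back forward error, so the two estimates chain.
    have h0 : ∀ u : ℝ → X, expSemigroup (-A) (T - T) (u T - openLoop A f xo (T - T)) =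
        u T - xo := by
      intro u
      simp [hR.map_zero, openLoop, hS.map_zero]
    rw [h0] at hfin₂
    have ha1 : a (j + 1) = ‖zm j T - xo‖ := by simp [ha]
    rw [ha1]
    -- The backward contraction factor is bounded by 1; the forward one already gives the rate.
    have hpos := mul_nonneg (mul_pos hδ (hκ j)).le
      (norm_nonneg (expSemigroup (-A) T (zp j T - openLoop A f xo T)))
    linarith
  -- Square summability sends κ to 0, so the smallness conditions hold eventually.
  have hsmall : ∀ κ₀ : ℝ, 0 < κ₀ → ∀ᶠ j in atTop, κ j ≤ κ₀ := fun κ₀ h₀ => by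
    filter_upwards [hκ_sq.tendsto_atTop_zero.eventually_lt_const (pow_pos h₀ 2)] with j hj
    exact (lt_of_pow_lt_pow_left₀ 2 h₀.le hj).le
  have hlim := tendsto_zero_of_recursion (a := a) (half_pos hδ) (fun n => norm_nonneg _) hκ hκ_sum hκ_sq
    (((hsmall _ hκ₁).and (hsmall _ hκ₂)).mono fun j hj => hstep j hj.1 hj.2)
  rw [tendsto_iff_norm_sub_tendsto_zero]
  simpa [ha] using (tendsto_add_atTop_iff_nat 1).2 hlim

end Convergence
end BFN

/-! ### The main theorem -/

theorem mainTheorem2 {𝕜 X Y : Type*} [RCLike 𝕜]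
    [NormedAddCommGroup X] [InnerProductSpace 𝕜 X] [NormedSpace ℝ X] [CompleteSpace X]
    [NormedAddCommGroup Y] [InnerProductSpace 𝕜 Y] [CompleteSpace Y]
    (A : X →ₗ.[𝕜] X) (Q : X →L[𝕜] X) (C : X →L[𝕜] Y)
    (f : ℝ → X) (y : ℝ → Y) (T δ : ℝ) (κ : ℕ → ℝ)
    (hT : 0 < T)
    (hA : BFN.IsGenerator A)
    (hESAD : BFN.IsESAD A Q)
    (hf : IntervalIntegrable f volume 0 T)
    (hy : MemLp y 2 (volume.restrict (Set.Ioc 0 T)))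
    (hδ : 0 < δ)
    (hobs : ∀ x : X, δ * ‖x‖ ^ 2 ≤ ∫ t in (0 : ℝ)..T, ‖C (BFN.expSemigroup A t x)‖ ^ 2)
    (hQ : 0 < Real.exp (-(‖Q‖ / 2 * T)) * δ - 3 * ‖C‖ ^ 2 * BFN.expGap (‖Q‖ / 2) T)
    (hκ : ∀ j, 0 < κ j)
    (hκ_sum : Tendsto (fun n => ∑ j ∈ Finset.range n, κ j) atTop atTop)
    (hκ_sq : Summable (fun j => κ j ^ 2)) :
    ∃ xo : X,
      (∀ x : X, x ≠ xo → BFN.cost A C f y T xo < BFN.cost A C f y T x) ∧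
      ∀ x₀ : X,
        (∃ zp zm : ℕ → ℝ → X, BFN.IsBFN A C f y T κ x₀ zp zm) ∧
        ∀ zp zm : ℕ → ℝ → X, BFN.IsBFN A C f y T κ x₀ zp zm →
          Tendsto (fun j => zm j T) atTop (𝓝 xo) := by
  obtain ⟨hS, hR, hS', hadj, hSR, hRS⟩ := hESAD.exists_inverse hA
  have hST := hS.stronglyContinuousOn T
  have hW : BFN.StronglyContinuousOn (fun t => C.comp (BFN.expSemigroup A t)) (Icc 0 T) :=
    hST.const_comp C
  -- Adjoints need not inherit strong continuity; here they do because S* is itself the semigroup of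
  -- A*.
  have hW' : BFN.StronglyContinuousOn
      (fun t => ContinuousLinearMap.adjoint (C.comp (BFN.expSemigroup A t))) (Icc 0 T) := fun v =>
    ((hS'.stronglyContinuousOn T).comp_const (ContinuousLinearMap.adjoint C) v).congr
      fun t ht => by
        simp only [ContinuousLinearMap.adjoint_comp, hadj t ht.1]
  have hloop : ∀ x, ContinuousOn (BFN.openLoop A f x) (Icc 0 T) := fun x => by
    refine (hST.continuousOn_apply isCompact_Icc ((continuousOn_const (c := x)).add
      (BFN.continuousOn_primitive_Icc hT.le
        ((hR.stronglyContinuousOn T).intervalIntegrable_apply hT.le hf)))).congr fun t ht => ?_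
    exact BFN.openLoop_eq hS hR hSR hf x ht
  have hres : ∀ x, MemLp (fun s => y s - C (BFN.openLoop A f x s)) 2
      (volume.restrict (Ioc 0 T)) := fun x =>
    hy.sub (BFN.memLp_two_of_continuousOn hT.le (C.continuous.comp_continuousOn (hloop x)))
  -- z[x] is affine in x, so J is the least-squares cost for W = C S with data y - C z[0].
  have hsplit : ∀ x s, y s - C (BFN.openLoop A f x s) =
      (y s - C (BFN.openLoop A f 0 s)) - (C.comp (BFN.expSemigroup A s)) x := fun x s => by
    rw [BFN.openLoop_eq_add, map_add, ContinuousLinearMap.comp_apply, sub_add_eq_sub_sub_swap]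
  obtain ⟨xo, hxo, hmin⟩ := BFN.exists_leastSquares_minimizer hT.le hδ hW hW' hobs (hres 0)
  have hH := hW'.comp hW isCompact_Icc
  refine ⟨xo, fun x hx => ?_, fun x₀ => ⟨?_, fun zp zm hz => ?_⟩⟩
  · simp only [BFN.cost, hsplit xo, hsplit x]
    exact mul_lt_mul_of_pos_left (hmin x hx) one_half_pos
  · have hyi := BFN.intervalIntegrable_of_memLp_two hT.le hy
    exact BFN.exists_isBFN κ x₀
      (fun j x => BFN.exists_forward_observer hT.le hS hR hS' hSR hf hyi (κ j) x)
      (fun j x => BFN.exists_backward_observer hT.le hS hR hS' hRS hf hyi (κ j) x)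
  · refine BFN.tendsto_of_isBFN hT.le hS hR hadj hSR hRS hf (fun _ => rfl) (fun _ => rfl) hH
      (hW'.intervalIntegrable_apply hT.le (BFN.intervalIntegrable_of_memLp_two hT.le (hres xo)))
      ?_ hδ (fun x => ?_) hκ hκ_sum hκ_sq hz
    · simpa only [hsplit xo] using hxo
    · rw [BFN.re_inner_integral_adjoint_comp_self hH hT.le]
      exact hobs x
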